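/- Setting. Let $G$ be a connected undirected graph on $m$ agents and let $A\in\mathbb R^{m\times m}$ be a symmetric row-stochastic matrix with nonnegative entries and positive diagonal whose positive off-diagonal entries are exactly the edges of $G$. Let $(X_k^j,Y_k^j)$, $k\ge 1$, $j\in\{1,\dots,m\}$, be i.i.d. pairs with $X_k^j\in\mathbb R^p$ and $Y_k^j\in\{0,1\}$, such that, given $X_k^j=x$, $Y_k^j$ is Bernoulli with success probability $e^{\langle\theta_0,x\rangle}/(1+e^{\langle\theta_0,x\rangle})$, for some $\theta_0\in\mathbb R^p$. For $\theta\in\mathbb R^p$ let $p_\theta(y\mid x)=\exp(\langle\theta,xy\rangle-\sigma(\langle\theta,x\rangle))$ with $\sigma(\eta)=\log(1+e^\eta)$, and let $P_\theta$ be the law of a pair $(X,Y)$ for which $X$ is distributed as $X_1^1$ and $Y$ given $X$ has probability mass function $p_\theta(\cdot\mid X)$. Write $\mathbb P_0$ for the true probability. Assume that $\theta_0$ is the unique minimizer of $\theta\mapsto\sum_{j=1}^m D_{KL}(P_{\theta_0}\,\|\,P_\theta)$ over $\mathbb R^p$ and that $\mathbb E|\log p_\theta(Y_1^1\mid X_1^1)|<\infty$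 for every $\theta\in\mathbb R^p$. For an agent $j$ and a time $t$ put $$T_t^j=\sum_{k=1}^t\sum_{i=1}^m [A^{t-k}]_{ji}X_k^iY_k^i,\qquad B_t^j(\theta)=\sum_{k=1}^t\sum_{i=1}^m [A^{t-k}]_{ji}\,\sigma(\langle\theta,X_k^i\rangle),$$ and let $\hat\theta_t^j$ be a maximizer of $\theta\mapsto\langle\theta,T_t^j\rangle-B_t^j(\theta)$ over $\mathbb R^p$ whenever a maximizer exists (and an arbitrary point of $\mathbb R^p$ otherwise). Let the agents have prior probability densities $\pi^1,\dots,\pi^m$ on $\mathbb R^p$ (for instance a common one), let $\Pi$ be the probability measure with density proportional to $\prod_{i=1}^m(\pi^i)^{1/m}$, and let the distributed Bayes posterior $P_t^j$ be the probability measure $$P_t^j(d\theta)\ \propto\ \prod_{k=1}^t\prod_{i=1}^m p_\theta(Y_k^i\mid X_k^i)^{[A^{t-k}]_{ij}}\ \Pi(d\theta).$$ (1) For every agent $j$, the probability that the maximizer exists and is unique tends to $1$ as $t\to\infty$, and $\hat\theta_t^j\to\theta_0$ in $\mathbb P_0$-probability. (2) Suppose in addition that every $\pi^i$ is continuous and positive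 at $\theta_0$, that $\mathbb E[X_1^1(X_1^1)^\top]$ exists, is finite and nonsingular, and that $\mathbb E|X_{1,a}^1X_{1,b}^1X_{1,c}^1|<\infty$ for all $a,b,c\in\{1,\dots,p\}$. Let $X^i$ be the $t\times p$ matrix with rows $X_1^i,\dots,X_t^i$, and let $$\hat V_\theta=\frac1{mt}\sum_{i=1}^m (X^i)^\top W^i(\theta)X^i,\qquad W^i(\theta)=\operatorname{diag}\left(\frac{e^{\langle\theta,X_k^i\rangle}}{(1+e^{\langle\theta,X_k^i\rangle})^2}\right)_{k=1,\dots,t}.$$ Then $\hat V_{\theta_0}$ is positive definite with probability tending to $1$, and for every agent $j$ the density $q_t^j$ of $\sqrt t(\theta-\hat\theta_t^j)$ under $\theta\sim P_t^j$ satisfies $$\int_{\mathbb R^p}\bigl|q_t^j(x)-N(0,\hat V_{\theta_0}^{-1})(x)\bigr|\,dx\ \longrightarrow\ 0\quad\text{in }\mathbb P_0\text{-probability},$$ where $N(0,\hat V_{\theta_0}^{-1})(x)$ is the Lebesgue density of that normal distribution. -/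

import Mathlib

open MeasureTheory ProbabilityTheory Filter Topology
open scoped ENNReal Matrix

namespace DistLogistic

/-- The softplus function `σ(η) = log (1 + e^η)`. -/
noncomputable def softplus (η : ℝ) : ℝ := Real.log (1 + Real.exp η)

/-- Conditional probability of the response `y ∈ {0, 1}` given the covariate `x` in the logistic
regression model: `p_θ(y ∣ x) = exp (⟨θ, y x⟩ - σ(⟨θ, x⟩))`. -/
noncomputable def condProb {p : ℕ} (θ x : EuclideanSpace ℝ (Fin p)) (y : Fin 2) : ℝ :=
  Real.exp (inner ℝ θ ((y : ℝ) • x) - softplus (inner ℝ θ x))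

/-- Joint law `P_θ` of one covariate/response pair `(X, Y)`: `X` has law `μ`, and given `X = x`
the response has the probability mass function `p_θ(· ∣ x)` on `{0, 1}`. -/
noncomputable def pairLaw {p : ℕ} (μ : Measure (EuclideanSpace ℝ (Fin p)))
    (θ : EuclideanSpace ℝ (Fin p)) : Measure (EuclideanSpace ℝ (Fin p) × Fin 2) :=
  (μ.prod Measure.count).withDensity (fun z => ENNReal.ofReal (condProb θ z.1 z.2))

/-- `A` is an admissible weight matrix for the communication graph `G` on the agents `Fin m`:
it is symmetric, row stochastic (with nonnegative entries), has positive diagonal, its positive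
off-diagonal entries are exactly the edges of `G`, and `G` is connected. -/
structure IsCommunicationMatrix {m : ℕ} (G : SimpleGraph (Fin m))
    (A : Matrix (Fin m) (Fin m) ℝ) : Prop where
  symm : A.IsSymm
  stochastic : A ∈ Matrix.rowStochastic ℝ (Fin m)
  diag_pos : ∀ i, 0 < A i i
  support : ∀ i j, i ≠ j → (0 < A i j ↔ G.Adj i j)
  connected : G.Connected

section Estimator

variable {m p : ℕ} (A : Matrix (Fin m) (Fin m) ℝ)
  (x : Fin m → ℕ → EuclideanSpace ℝ (Fin p)) (y : Fin m → ℕ → Fin 2)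

/-- The statistic `T_t^j`. Observations are indexed from `0`, so that the observation with
index `k < t` is the `(k+1)`-st and carries the weight `[A^(t-(k+1))]_{ji}`. -/
noncomputable def sufficientStat (t : ℕ) (j : Fin m) : EuclideanSpace ℝ (Fin p) :=
  ∑ k ∈ Finset.range t, ∑ i, (A ^ (t - (k + 1))) j i • ((y i k : ℝ) • x i k)

/-- The log-partition function `B_t^j(θ)`. -/
noncomputable def logPartition (t : ℕ) (j : Fin m) (θ : EuclideanSpace ℝ (Fin p)) : ℝ :=
  ∑ k ∈ Finset.range t, ∑ i, (A ^ (t - (k + 1))) j i * softplus (inner ℝ θ (x i k))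

/-- `θ` is a maximizer over `ℝ^p` of `θ ↦ ⟨θ, T_t^j⟩ - B_t^j(θ)`. -/
def IsMEstimate (t : ℕ) (j : Fin m) (θ : EuclideanSpace ℝ (Fin p)) : Prop :=
  ∀ θ' : EuclideanSpace ℝ (Fin p),
    inner ℝ θ' (sufficientStat A x y t j) - logPartition A x t j θ' ≤
      inner ℝ θ (sufficientStat A x y t j) - logPartition A x t j θ

/-- The surrogate likelihood of agent `j` at time `t`: the product of the model probabilities of
the `k`-th observation of agent `i`, raised to the power `[A^(t-k)]_{ij}`, over `k = 1, …, t` and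
all agents `i`. (For `k = t` the exponents are those of the identity matrix, so that only agent
`j`'s own newest observation enters.) -/
noncomputable def surrogateLikelihood (t : ℕ) (j : Fin m) (θ : EuclideanSpace ℝ (Fin p)) : ℝ :=
  ∏ k ∈ Finset.range t, ∏ i, condProb θ (x i k) (y i k) ^ ((A ^ (t - (k + 1))) i j)

/-- The common prior: the probability measure whose Lebesgue density is proportional to the
geometric mean of the prior densities of the agents. -/
noncomputable def priorMeasure (π : Fin m → EuclideanSpace ℝ (Fin p) → ℝ) :
    Measure (EuclideanSpace ℝ (Fin p)) :=
  (∫⁻ θ, ENNReal.ofReal (∏ j, π j θ ^ (1 / m : ℝ)))⁻¹ •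
    (volume.withDensity fun θ => ENNReal.ofReal (∏ j, π j θ ^ (1 / m : ℝ)))

/-- The distributed Bayes posterior `P_t^j`: prior times surrogate likelihood, normalized. -/
noncomputable def posterior (π : Fin m → EuclideanSpace ℝ (Fin p) → ℝ) (t : ℕ) (j : Fin m) :
    Measure (EuclideanSpace ℝ (Fin p)) :=
  (∫⁻ θ, ENNReal.ofReal (surrogateLikelihood A x y t j θ) ∂(priorMeasure π))⁻¹ •
    ((priorMeasure π).withDensity fun θ => ENNReal.ofReal (surrogateLikelihood A x y t j θ))

/-- The `t × p` design matrix of agent `i`. -/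
def designMatrix (t : ℕ) (i : Fin m) : Matrix (Fin t) (Fin p) ℝ :=
  Matrix.of fun k a => x i k a

/-- The diagonal weights `W^i(θ)`, with entries `e^{⟨θ, x_k^i⟩} / (1 + e^{⟨θ, x_k^i⟩})^2`. -/
noncomputable def weightMatrix (t : ℕ) (i : Fin m) (θ : EuclideanSpace ℝ (Fin p)) :
    Matrix (Fin t) (Fin t) ℝ :=
  Matrix.diagonal fun k =>
    Real.exp (inner ℝ θ (x i k)) / (1 + Real.exp (inner ℝ θ (x i k))) ^ 2

/-- The Fisher information, averaged over agents and observations,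
`(1 / (m t)) ∑_i (X^i)ᵀ W^i(θ) X^i`. -/
noncomputable def avgFisher (t : ℕ) (θ : EuclideanSpace ℝ (Fin p)) : Matrix (Fin p) (Fin p) ℝ :=
  (1 / ((m : ℝ) * (t : ℝ))) •
    ∑ i, (designMatrix x t i)ᵀ * weightMatrix x t i θ * designMatrix x t i

end Estimator

/-- Lebesgue density of the centered normal distribution `N(0, S)` on `ℝ^p`, for a positive
definite covariance matrix `S`. -/
noncomputable def gaussianDensity {p : ℕ} (S : Matrix (Fin p) (Fin p) ℝ)
    (h : EuclideanSpace ℝ (Fin p)) : ℝ :=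
  (Real.sqrt ((2 * Real.pi) ^ p * S.det))⁻¹ * Real.exp (-(h.ofLp ⬝ᵥ (S⁻¹ *ᵥ h.ofLp)) / 2)

end DistLogistic

/-! A symmetric stochastic matrix with positive diagonal and connected support is primitive and
doubly stochastic, so its powers converge entrywise to 1/m (`tendsto_pow_apply`). An agent's
weighted sum, divided by t, therefore differs from the network average by a term whose L¹ norm is at
most a constant times a sum of Cesàro means of |[A^n]_{ji} - 1/m|. This gives every agent a law of
large numbers under a first moment alone (`tendsto_weighted_average`). Symmetry of A also makes the
surrogate likelihood the exponential of the M-estimation criterion (`surrogateLikelihood_eq_exp`),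
so both claims concern one random concave function, `agentLogLik`.

Consistency. By Gibbs' inequality (`integral_log_condProb_lt`) the limiting criterion is strictly
larger at θ₀ than elsewhere. The criterion divided by t is Lipschitz, with constant twice the
weighted average of the covariate norms, so finitely many parameters control it on a small sphere
around θ₀. With high probability θ₀ beats the whole sphere, and concavity extends this to the
outside. The maximizer then exists, is unique and lies in the ball. The required first moment of the
covariate comes from integrability of the log-likelihood at θ and at -θ
(`abs_log_condProb_neg_sub`).

Bernstein-von Mises. At the maximizer the linear term vanishes, and the log-likelihood ratio is
-t⟨u, Vu⟩/2, with V the population Fisher information, up to t(η‖u‖² + R‖u‖³) with η → 0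
(`abs_agentLogLik_sub_le`). In Laplace's method (`tendsto_integral_abs_localDensity_sub`) dominated
convergence handles a fixed neighbourhood; outside it concavity makes the ratio exponentially small
in t, which beats the factor √t^p. Normalization preserves L¹ convergence, and N(0, V⁻¹) is finally
replaced by the normal law with empirical precision.

Convergence in probability is convergence along the filter `inProb P`, defined through outer
measure, so the estimator need not be measurable. Where dominated convergence is needed, a coarser
countably generated filter replaces it. -/

namespace DistLogistic

/-! ### Derivatives and Taylor bounds of the softplus function -/

section Softplus

lemma hasDerivAt_softplus (b : ℝ) : HasDerivAt softplus (Real.sigmoid b) b := by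
  have h : HasDerivAt (fun η : ℝ => Real.log (1 + Real.exp η))
      (Real.exp b / (1 + Real.exp b)) b :=
    ((Real.hasDerivAt_exp b).const_add 1).log (by positivity)
  have e : Real.sigmoid b = Real.exp b / (1 + Real.exp b) := by
    rw [Real.sigmoid_def, Real.exp_neg]
    field_simp
    ring
  rw [e]
  exact h

lemma continuous_softplus : Continuous softplus :=
  continuous_iff_continuousAt.2 fun b => (hasDerivAt_softplus b).continuousAt

/-- The variance function `σ''` of the Bernoulli family. -/
noncomputable def bernVar (b : ℝ) : ℝ := Real.sigmoid b * (1 - Real.sigmoid b)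

lemma hasDerivAt_sigmoid' (b : ℝ) : HasDerivAt Real.sigmoid (bernVar b) b :=
  Real.hasDerivAt_sigmoid b

lemma hasDerivAt_bernVar (b : ℝ) :
    HasDerivAt bernVar (bernVar b * (1 - 2 * Real.sigmoid b)) b := by
  have h := (hasDerivAt_sigmoid' b).mul ((hasDerivAt_sigmoid' b).const_sub 1)
  refine h.congr_deriv ?_
  ring

lemma continuous_bernVar : Continuous bernVar :=
  continuous_iff_continuousAt.2 fun b => (hasDerivAt_bernVar b).continuousAt

lemma bernVar_pos (b : ℝ) : 0 < bernVar b :=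
  mul_pos (Real.sigmoid_pos b) (sub_pos.2 (Real.sigmoid_lt_one b))

lemma bernVar_le_one (b : ℝ) : bernVar b ≤ 1 := by
  have h1 := Real.sigmoid_pos b
  have h2 := Real.sigmoid_lt_one b
  unfold bernVar
  nlinarith

lemma bernVar_eq (b : ℝ) : bernVar b = Real.exp b / (1 + Real.exp b) ^ 2 := by
  rw [bernVar, Real.sigmoid_def, Real.exp_neg]
  have := Real.exp_pos b
  field_simp
  ring

/-- Mean value inequality on the symmetric interval spanned by `d`. -/
lemma abs_le_of_hasDerivAt_le {f f' : ℝ → ℝ} {C d : ℝ} (h0 : f 0 = 0)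
    (hf : ∀ s, HasDerivAt f (f' s) s) (hb : ∀ s, |s| ≤ |d| → |f' s| ≤ C) :
    |f d| ≤ C * |d| := by
  have hconv : Convex ℝ (Metric.closedBall (0 : ℝ) |d|) := convex_closedBall _ _
  have := hconv.norm_image_sub_le_of_norm_hasDerivWithin_le (f := f) (f' := f') (C := C)
    (fun s _ => (hf s).hasDerivWithinAt) (fun s hs => by
      simpa using hb s (by simpa using hs)) (x := 0) (y := d) (by simp) (by simp)
  simpa [h0] using this

lemma abs_softplus_add_sub_le (b d : ℝ) : |softplus (b + d) - softplus b| ≤ |d| := by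
  have := abs_le_of_hasDerivAt_le (f := fun s => softplus (b + s) - softplus b)
    (f' := fun s => Real.sigmoid (b + s)) (C := 1) (d := d) (by simp)
    (fun s => ((hasDerivAt_softplus (b + s)).comp_const_add b s).sub_const _)
    (fun s _ => by
      rw [abs_of_pos (Real.sigmoid_pos _)]
      exact Real.sigmoid_le_one _)
  simpa using this

lemma abs_bernVar_add_sub_le (b d : ℝ) : |bernVar (b + d) - bernVar b| ≤ |d| := by
  have := abs_le_of_hasDerivAt_le (f := fun s => bernVar (b + s) - bernVar b)
    (f' := fun s => bernVar (b + s) * (1 - 2 * Real.sigmoid (b + s))) (C := 1) (d := d) (by simp)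
    (fun s => ((hasDerivAt_bernVar (b + s)).comp_const_add b s).sub_const _)
    (fun s _ => by
      rw [abs_mul, abs_of_pos (bernVar_pos _)]
      have h1 := Real.sigmoid_pos (b + s)
      have h2 := Real.sigmoid_lt_one (b + s)
      have h3 : |1 - 2 * Real.sigmoid (b + s)| ≤ 1 := by
        rw [abs_le]; constructor <;> linarith
      exact mul_le_one₀ (bernVar_le_one _) (abs_nonneg _) h3)
  simpa using this

/-- The Lipschitz bound for σ'' is integrated twice by the mean value inequality. The constant is
not optimal, but it is uniform in b, which is what sums over observations require. -/
lemma abs_softplus_taylor_le (b d : ℝ) :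
    |softplus (b + d) - softplus b - Real.sigmoid b * d - bernVar b * d ^ 2 / 2| ≤ |d| ^ 3 := by
  have h1 : ∀ e : ℝ, |Real.sigmoid (b + e) - Real.sigmoid b - bernVar b * e| ≤ |e| ^ 2 := by
    intro e
    have := abs_le_of_hasDerivAt_le
      (f := fun s => Real.sigmoid (b + s) - Real.sigmoid b - bernVar b * s)
      (f' := fun s => bernVar (b + s) - bernVar b) (C := |e|) (d := e) (by simp)
      (fun s => by
        have := (((hasDerivAt_sigmoid' (b + s)).comp_const_add b s).sub_const
          (Real.sigmoid b)).sub ((hasDerivAt_id s).const_mul (bernVar b))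
        refine this.congr_deriv ?_
        ring)
      (fun s hs => (abs_bernVar_add_sub_le b s).trans hs)
    simpa [sq] using this
  have := abs_le_of_hasDerivAt_le
    (f := fun s => softplus (b + s) - softplus b - Real.sigmoid b * s - bernVar b * s ^ 2 / 2)
    (f' := fun s => Real.sigmoid (b + s) - Real.sigmoid b - bernVar b * s)
    (C := |d| ^ 2) (d := d) (by simp)
    (fun s => by
      have := ((((hasDerivAt_softplus (b + s)).comp_const_add b s).sub_const
        (softplus b)).sub ((hasDerivAt_id s).const_mul (Real.sigmoid b))).sub
        (((hasDerivAt_pow 2 s).const_mul (bernVar b)).div_const 2)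
      refine this.congr_deriv ?_
      simp
      ring)
    (fun s hs => (h1 s).trans (by gcongr))
  calc _ ≤ |d| ^ 2 * |d| := this
    _ = |d| ^ 3 := by ring

lemma strictConvexOn_softplus : StrictConvexOn ℝ Set.univ softplus := by
  apply StrictMono.strictConvexOn_univ_of_deriv continuous_softplus
  have : deriv softplus = Real.sigmoid := funext fun b => (hasDerivAt_softplus b).deriv
  rw [this]
  exact Real.sigmoid_strictMono

lemma softplus_neg (η : ℝ) : softplus (-η) = softplus η - η := by
  unfold softplus
  have h : 1 + Real.exp (-η) = (1 + Real.exp η) / Real.exp η := by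
    rw [Real.exp_neg]; field_simp; ring
  rw [h, Real.log_div (by positivity) (by positivity), Real.log_exp]

end Softplus

/-! ### Weighted logistic log-likelihoods: concavity, maximizers, expansion -/

section LogLik

variable {E : Type*} [NormedAddCommGroup E] [InnerProductSpace ℝ E] {α : Type*}
  {S : Finset α} {w : α → ℝ} {x : α → E} {y : α → ℝ}

/-- The weighted logistic log-likelihood. -/
noncomputable def logLik (S : Finset α) (w : α → ℝ) (x : α → E) (y : α → ℝ) (θ : E) : ℝ :=
  ∑ a ∈ S, w a * (y a * inner ℝ θ (x a) - softplus (inner ℝ θ (x a)))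

lemma continuous_logLik : Continuous (logLik S w x y) := by
  unfold logLik
  refine continuous_finsetSum _ fun a _ => ?_
  have : Continuous fun θ : E => (inner ℝ θ (x a) : ℝ) := by fun_prop
  exact continuous_const.mul ((continuous_const.mul this).sub (continuous_softplus.comp this))

lemma concaveOn_logLik (hw : ∀ a ∈ S, 0 ≤ w a) : ConcaveOn ℝ Set.univ (logLik S w x y) := by
  refine ⟨convex_univ, fun θ _ θ' _ r s hr hs hrs => ?_⟩
  simp only [logLik, smul_eq_mul, Finset.mul_sum, ← Finset.sum_add_distrib]
  refine Finset.sum_le_sum fun a ha => ?_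
  have h := strictConvexOn_softplus.convexOn.2 (Set.mem_univ (inner ℝ θ (x a)))
    (Set.mem_univ (inner ℝ θ' (x a))) hr hs hrs
  simp only [smul_eq_mul] at h
  simp only [inner_add_left, real_inner_smul_left]
  nlinarith [hw a ha, mul_le_mul_of_nonneg_left h (hw a ha)]

/-- Both the linear part and σ are 1-Lipschitz in ⟨θ, x⟩. The resulting Lipschitz constant is a
weighted sum of norms, to which the law of large numbers applies. -/
lemma abs_logLik_sub_le (hw : ∀ a ∈ S, 0 ≤ w a) (hy : ∀ a ∈ S, |y a| ≤ 1) (θ θ' : E) :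
    |logLik S w x y θ' - logLik S w x y θ| ≤ 2 * ‖θ' - θ‖ * ∑ a ∈ S, w a * ‖x a‖ := by
  rw [logLik, logLik, ← Finset.sum_sub_distrib, Finset.mul_sum]
  refine (Finset.abs_sum_le_sum_abs _ _).trans (Finset.sum_le_sum fun a ha => ?_)
  have h1 := abs_softplus_add_sub_le (inner ℝ θ (x a)) (inner ℝ (θ' - θ) (x a))
  have h2 : |(inner ℝ (θ' - θ) (x a) : ℝ)| ≤ ‖θ' - θ‖ * ‖x a‖ := abs_real_inner_le_norm _ _
  have e : (inner ℝ θ (x a) : ℝ) + inner ℝ (θ' - θ) (x a) = inner ℝ θ' (x a) := by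
    rw [← inner_add_left]; simp
  rw [e] at h1
  have h3 : |y a * (inner ℝ (θ' - θ) (x a) : ℝ)| ≤ ‖θ' - θ‖ * ‖x a‖ := by
    rw [abs_mul]
    exact (mul_le_of_le_one_left (abs_nonneg _) (hy a ha)).trans h2
  have e2 : w a * (y a * inner ℝ θ' (x a) - softplus (inner ℝ θ' (x a))) -
      w a * (y a * inner ℝ θ (x a) - softplus (inner ℝ θ (x a))) =
      w a * (y a * inner ℝ (θ' - θ) (x a) -
        (softplus (inner ℝ θ' (x a)) - softplus (inner ℝ θ (x a)))) := by
    rw [inner_sub_left]; ring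
  rw [e2, abs_mul, abs_of_nonneg (hw a ha)]
  calc w a * |y a * inner ℝ (θ' - θ) (x a) -
        (softplus (inner ℝ θ' (x a)) - softplus (inner ℝ θ (x a)))|
      ≤ w a * (‖θ' - θ‖ * ‖x a‖ + ‖θ' - θ‖ * ‖x a‖) := by
        refine mul_le_mul_of_nonneg_left ((abs_sub _ _).trans ?_) (hw a ha)
        exact add_le_add h3 (h1.trans h2)
    _ = 2 * ‖θ' - θ‖ * (w a * ‖x a‖) := by ring

/-- If the value at the centre of a ball beats all values on the bounding sphere, then so it does
outside of the ball. -/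
lemma logLik_lt_of_sphere (hw : ∀ a ∈ S, 0 ≤ w a) {θ₀ : E} {ε : ℝ} (hε : 0 < ε)
    (hs : ∀ θ ∈ Metric.sphere θ₀ ε, logLik S w x y θ < logLik S w x y θ₀)
    {θ : E} (hθ : ε ≤ dist θ θ₀) : logLik S w x y θ < logLik S w x y θ₀ := by
  have hd : 0 < dist θ θ₀ := hε.trans_le hθ
  set r : ℝ := ε / dist θ θ₀ with hr
  have hr0 : 0 < r := div_pos hε hd
  have hr1 : r ≤ 1 := (div_le_one hd).2 hθ
  have hmem : (1 - r) • θ₀ + r • θ ∈ Metric.sphere θ₀ ε := by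
    rw [mem_sphere_iff_norm]
    have : (1 - r) • θ₀ + r • θ - θ₀ = r • (θ - θ₀) := by module
    rw [this, norm_smul, Real.norm_of_nonneg hr0.le, ← dist_eq_norm, hr, div_mul_cancel₀ _ hd.ne']
  have h1 := hs _ hmem
  have h2 := (concaveOn_logLik (y := y) (x := x) hw).2 (Set.mem_univ θ₀) (Set.mem_univ θ)
    (sub_nonneg.2 hr1) hr0.le (by ring)
  simp only [smul_eq_mul] at h2
  by_contra hcon
  push Not at hcon
  nlinarith

/-- Existence is compactness of the closed ball. For uniqueness the covariates need not span E: a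
second maximizer would create a line of maximizers, yet all of them lie in the ball. -/
lemma existsUnique_maximizer [FiniteDimensional ℝ E] (hw : ∀ a ∈ S, 0 ≤ w a) {θ₀ : E} {ε : ℝ}
    (hε : 0 < ε) (hs : ∀ θ ∈ Metric.sphere θ₀ ε, logLik S w x y θ < logLik S w x y θ₀) :
    ∃! θ, ∀ θ', logLik S w x y θ' ≤ logLik S w x y θ := by
  have hout : ∀ θ, (∀ θ', logLik S w x y θ' ≤ logLik S w x y θ) → dist θ θ₀ < ε := by
    intro θ h
    by_contra hcon
    push Not at hcon
    exact absurd (logLik_lt_of_sphere hw hε hs hcon) (not_lt.2 (h θ₀))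
  obtain ⟨θ, -, hθ⟩ := (isCompact_closedBall θ₀ ε).exists_isMaxOn
    ⟨θ₀, Metric.mem_closedBall_self hε.le⟩ (continuous_logLik (S := S) (w := w) (x := x)
      (y := y)).continuousOn
  have hmax : ∀ θ', logLik S w x y θ' ≤ logLik S w x y θ := by
    intro θ'
    rcases le_total (dist θ' θ₀) ε with h | h
    · exact hθ h
    · exact (logLik_lt_of_sphere hw hε hs h).le.trans (hθ (Metric.mem_closedBall_self hε.le))
  refine ⟨θ, hmax, fun θ' hθ' => ?_⟩
  by_contra hne
  set v := θ' - θ with hv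
  have hv0 : v ≠ 0 := sub_ne_zero.2 hne
  -- Otherwise strict convexity of σ would make the midpoint of the two maximizers strictly better
  -- than both.
  have horth : ∀ a ∈ S, w a ≠ 0 → (inner ℝ v (x a) : ℝ) = 0 := by
    intro a ha hwa
    by_contra hin
    have hne' : (inner ℝ θ (x a) : ℝ) ≠ inner ℝ θ' (x a) := by
      intro h
      apply hin
      rw [hv, inner_sub_left, h, sub_self]
    have hlt : (1 / 2 : ℝ) * logLik S w x y θ + (1 / 2 : ℝ) * logLik S w x y θ' <
        logLik S w x y ((1 / 2 : ℝ) • θ + (1 / 2 : ℝ) • θ') := by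
      simp only [logLik, Finset.mul_sum, ← Finset.sum_add_distrib]
      refine Finset.sum_lt_sum (fun b hb => ?_) ⟨a, ha, ?_⟩
      · have h := strictConvexOn_softplus.convexOn.2 (Set.mem_univ (inner ℝ θ (x b)))
          (Set.mem_univ (inner ℝ θ' (x b))) (show (0 : ℝ) ≤ 1 / 2 by norm_num)
          (show (0 : ℝ) ≤ 1 / 2 by norm_num) (by norm_num)
        simp only [smul_eq_mul] at h
        simp only [inner_add_left, real_inner_smul_left]
        nlinarith [hw b hb, mul_le_mul_of_nonneg_left h (hw b hb)]
      · have h := strictConvexOn_softplus.2 (Set.mem_univ (inner ℝ θ (x a)))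
          (Set.mem_univ (inner ℝ θ' (x a))) hne' (show (0 : ℝ) < 1 / 2 by norm_num)
          (show (0 : ℝ) < 1 / 2 by norm_num) (by norm_num)
        simp only [smul_eq_mul] at h
        simp only [inner_add_left, real_inner_smul_left]
        have hpos : 0 < w a := lt_of_le_of_ne (hw a ha) (Ne.symm hwa)
        nlinarith [mul_lt_mul_of_pos_left h hpos]
    have h1 := hmax ((1 / 2 : ℝ) • θ + (1 / 2 : ℝ) • θ')
    have h2 := hθ' θ
    linarith
  -- A shift along v by length 2ε, the diameter of the ball, leaves the value unchanged, but two
  -- points of the open ball are closer than that.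
  set R : ℝ := 2 * ε / ‖v‖ with hR
  have hvn : 0 < ‖v‖ := norm_pos_iff.2 hv0
  have hconst : logLik S w x y (θ + R • v) = logLik S w x y θ := by
    refine Finset.sum_congr rfl fun a ha => ?_
    by_cases hwa : w a = 0
    · simp [hwa]
    · simp [inner_add_left, real_inner_smul_left, horth a ha hwa]
  have h1 : dist (θ + R • v) θ₀ < ε := hout _ (by rw [hconst]; exact hmax)
  have h2 : dist θ θ₀ < ε := hout _ hmax
  have h3 : dist (θ + R • v) θ = 2 * ε := by
    rw [dist_eq_norm, add_sub_cancel_left, norm_smul, Real.norm_of_nonneg (by positivity), hR,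
      div_mul_cancel₀ _ hvn.ne']
  have h4 := dist_triangle_right (θ + R • v) θ θ₀
  linarith

/-- Second order expansion of the log-likelihood at a maximizer. -/
lemma abs_logLik_taylor_le (hw : ∀ a ∈ S, 0 ≤ w a) {θ : E}
    (hmax : ∀ θ', logLik S w x y θ' ≤ logLik S w x y θ) (u : E) :
    |logLik S w x y (θ + u) - logLik S w x y θ +
      (∑ a ∈ S, w a * (bernVar (inner ℝ θ (x a)) * inner ℝ u (x a) ^ 2)) / 2| ≤
      ∑ a ∈ S, w a * |inner ℝ u (x a)| ^ 3 := by
  -- The score in direction u vanishes because s = 0 maximizes the criterion along θ + s u;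
  -- subtracting this zero removes the linear term of the expansion.
  have hgrad : ∑ a ∈ S, w a * (y a * inner ℝ u (x a) -
      Real.sigmoid (inner ℝ θ (x a)) * inner ℝ u (x a)) = 0 := by
    have hder : HasDerivAt (fun s : ℝ => logLik S w x y (θ + s • u))
        (∑ a ∈ S, w a * (y a * inner ℝ u (x a) -
          Real.sigmoid (inner ℝ θ (x a)) * inner ℝ u (x a))) 0 := by
      unfold logLik
      refine HasDerivAt.fun_sum fun a _ => ?_
      have hin : HasDerivAt (fun s : ℝ => (inner ℝ (θ + s • u) (x a) : ℝ)) (inner ℝ u (x a)) 0 := by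
        simp only [inner_add_left, real_inner_smul_left]
        simpa using ((hasDerivAt_id (0 : ℝ)).mul_const (inner ℝ u (x a) : ℝ)).const_add
          (inner ℝ θ (x a) : ℝ)
      refine (((hin.const_mul (y a)).sub
        (HasDerivAt.comp (0 : ℝ) (h₂ := softplus) (hasDerivAt_softplus _) hin)).const_mul
          (w a)).congr_deriv ?_
      simp
    refine IsLocalMax.hasDerivAt_eq_zero ?_ hder
    exact Eventually.of_forall fun s => by simpa using hmax _
  have e : logLik S w x y (θ + u) - logLik S w x y θ +
      (∑ a ∈ S, w a * (bernVar (inner ℝ θ (x a)) * inner ℝ u (x a) ^ 2)) / 2 =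
      ∑ a ∈ S, w a * (-(softplus (inner ℝ θ (x a) + inner ℝ u (x a)) - softplus (inner ℝ θ (x a)) -
        Real.sigmoid (inner ℝ θ (x a)) * inner ℝ u (x a) -
        bernVar (inner ℝ θ (x a)) * inner ℝ u (x a) ^ 2 / 2)) := by
    rw [← sub_zero (logLik S w x y (θ + u) - logLik S w x y θ + _), ← hgrad, logLik, logLik,
      ← Finset.sum_sub_distrib, Finset.sum_div, ← Finset.sum_add_distrib,
      ← Finset.sum_sub_distrib]
    refine Finset.sum_congr rfl fun a _ => ?_
    rw [inner_add_left]
    ring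
  rw [e]
  refine (Finset.abs_sum_le_sum_abs _ _).trans (Finset.sum_le_sum fun a ha => ?_)
  rw [abs_mul, abs_of_nonneg (hw a ha), abs_neg]
  exact mul_le_mul_of_nonneg_left (abs_softplus_taylor_le _ _) (hw a ha)

end LogLik

/-! ### Convergence of the powers of the communication matrix -/

section MatrixPowers

variable {m : ℕ} {A : Matrix (Fin m) (Fin m) ℝ}

/-- Edges carry positive weight, and the positive diagonal permits waiting, so a walk can be padded
to any greater length. This lets one exponent serve all pairs of agents. -/
lemma pow_apply_pos_of_walk {G : SimpleGraph (Fin m)} (hA : IsCommunicationMatrix G A)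
    {i j : Fin m} (q : G.Walk i j) : ∀ n, q.length ≤ n → 0 < (A ^ n) i j := by
  have hnn : ∀ n i j, 0 ≤ (A ^ n) i j := fun n i j =>
    Matrix.nonneg_of_mem_rowStochastic (pow_mem hA.stochastic n)
  have step : ∀ n i k j, 0 < A i k → 0 < (A ^ n) k j → 0 < (A ^ (n + 1)) i j := by
    intro n i k j h1 h2
    rw [pow_succ', Matrix.mul_apply]
    exact Finset.sum_pos' (fun l _ => mul_nonneg (hA.stochastic.1 _ _) (hnn _ _ _))
      ⟨k, Finset.mem_univ _, mul_pos h1 h2⟩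
  induction q with
  | nil =>
    intro n _
    induction n with
    | zero => simp
    | succ n ih => exact step n _ _ _ (hA.diag_pos _) (ih (Nat.zero_le _))
  | cons h q ih =>
    intro n hn
    rw [SimpleGraph.Walk.length_cons] at hn
    obtain ⟨n, rfl⟩ : ∃ n', n = n' + 1 := ⟨n - 1, by omega⟩
    exact step n _ _ _ ((hA.support _ _ h.ne).2 h) (ih n (by omega))

lemma exists_pow_pos {G : SimpleGraph (Fin m)} (hA : IsCommunicationMatrix G A) :
    ∃ N, ∀ i j, 0 < (A ^ N) i j := by
  have q : ∀ i j, G.Walk i j := fun i j => (hA.connected.preconnected i j).some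
  refine ⟨Finset.univ.sup fun ij : Fin m × Fin m => (q ij.1 ij.2).length, fun i j => ?_⟩
  exact pow_apply_pos_of_walk hA (q i j) _
    (Finset.le_sup (f := fun ij : Fin m × Fin m => (q ij.1 ij.2).length) (Finset.mem_univ (i, j)))

/-- Doeblin contraction of the oscillation of a vector. -/
lemma abs_mulVec_sub_le {B : Matrix (Fin m) (Fin m) ℝ} (hB : B ∈ Matrix.rowStochastic ℝ (Fin m))
    {ε : ℝ} (hε : ∀ i j, ε ≤ B i j) {v : Fin m → ℝ} {d : ℝ} (hv : ∀ i j, |v i - v j| ≤ d)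
    (i j : Fin m) : |(B *ᵥ v) i - (B *ᵥ v) j| ≤ (1 - ε) * d := by
  have : Nonempty (Fin m) := ⟨i⟩
  -- Measured from the smallest entry v k, the term l = k contributes nothing, so each row loses
  -- mass B i k ≥ ε.
  obtain ⟨k, hk⟩ := Finite.exists_min v
  have hd : 0 ≤ d := (abs_nonneg _).trans (hv i j)
  have key : ∀ i, 0 ≤ (B *ᵥ v) i - v k ∧ (B *ᵥ v) i - v k ≤ (1 - ε) * d := by
    intro i
    have hs := Matrix.sum_row_of_mem_rowStochastic hB i
    have e : (B *ᵥ v) i - v k = ∑ l, B i l * (v l - v k) := by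
      simp only [mul_sub, Finset.sum_sub_distrib, ← Finset.sum_mul, hs, one_mul]
      rfl
    rw [e]
    refine ⟨Finset.sum_nonneg fun l _ => mul_nonneg (hB.1 _ _) (sub_nonneg.2 (hk l)), ?_⟩
    calc ∑ l, B i l * (v l - v k) = ∑ l ∈ Finset.univ.erase k, B i l * (v l - v k) := by
          rw [← Finset.add_sum_erase _ _ (Finset.mem_univ k)]; simp
      _ ≤ ∑ l ∈ Finset.univ.erase k, B i l * d := by
          refine Finset.sum_le_sum fun l _ => mul_le_mul_of_nonneg_left ?_ (hB.1 _ _)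
          exact (le_abs_self _).trans (hv l k)
      _ = (1 - B i k) * d := by
          rw [← Finset.sum_mul, ← hs, ← Finset.add_sum_erase _ _ (Finset.mem_univ k)]
          ring
      _ ≤ (1 - ε) * d := by
          refine mul_le_mul_of_nonneg_right ?_ hd
          linarith [hε i k]
  have h1 := key i
  have h2 := key j
  rw [abs_le]
  constructor <;> linarith [h1.1, h1.2, h2.1, h2.2]

/-- A column of A^n has oscillation at most (1 - ε)^(n / N) by repeated contraction. By symmetry its
entries sum to one, so their mean is 1/m and each entry is close to it. -/
lemma tendsto_pow_apply {G : SimpleGraph (Fin m)} (hA : IsCommunicationMatrix G A)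
    (i j : Fin m) : Tendsto (fun n => (A ^ n) i j) atTop (𝓝 (1 / m)) := by
  obtain ⟨N, hN⟩ := exists_pow_pos hA
  have : Nonempty (Fin m) := ⟨i⟩
  obtain ⟨⟨a, b⟩, hab⟩ := Finite.exists_min fun ij : Fin m × Fin m => (A ^ N) ij.1 ij.2
  set ε := (A ^ N) a b with hεd
  have hε : 0 < ε := hN a b
  have hεle : ∀ i j, ε ≤ (A ^ N) i j := fun i j => hab (i, j)
  have hst := fun n => pow_mem hA.stochastic n
  have hε1 : ε ≤ 1 := Matrix.le_one_of_mem_rowStochastic (hst N)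
  have hosc : ∀ q r i' i'' , |(A ^ (N * q + r)) i' j - (A ^ (N * q + r)) i'' j| ≤ (1 - ε) ^ q := by
    intro q r
    induction q with
    | zero =>
      intro i' i''
      have h1 : 0 ≤ (A ^ r) i' j := Matrix.nonneg_of_mem_rowStochastic (hst r)
      have h2 : (A ^ r) i' j ≤ 1 := Matrix.le_one_of_mem_rowStochastic (hst r)
      have h3 : 0 ≤ (A ^ r) i'' j := Matrix.nonneg_of_mem_rowStochastic (hst r)
      have h4 : (A ^ r) i'' j ≤ 1 := Matrix.le_one_of_mem_rowStochastic (hst r)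
      simp only [mul_zero, zero_add, pow_zero]
      rw [abs_le]
      constructor <;> linarith
    | succ q ih =>
      intro i' i''
      have := abs_mulVec_sub_le (hst N) hεle (v := fun l => (A ^ (N * q + r)) l j) ih i' i''
      have e : ∀ l, ((A ^ N) *ᵥ fun l => (A ^ (N * q + r)) l j) l =
          (A ^ (N * (q + 1) + r)) l j := by
        intro l
        rw [show N * (q + 1) + r = N + (N * q + r) by ring, pow_add A N, Matrix.mul_apply]
        rfl
      rw [e, e] at this
      rw [pow_succ']
      exact this
  have hm : (m : ℝ) ≠ 0 := by
    have := Fin.pos i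
    positivity
  have hN0 : N = 0 ∨ 0 < N := Nat.eq_zero_or_pos N
  have hbound : ∀ n, |(A ^ n) i j - 1 / m| ≤ (1 - ε) ^ (n / N) := by
    intro n
    have hcol : ∑ l, (A ^ n) l j = 1 := by
      have hsym : ∀ l, (A ^ n) l j = (A ^ n) j l := fun l => (hA.symm.pow n).apply j l
      simp only [hsym]
      exact Matrix.sum_row_of_mem_rowStochastic (hst n) j
    have e : (A ^ n) i j - 1 / m = (∑ l, ((A ^ n) i j - (A ^ n) l j)) / m := by
      rw [Finset.sum_sub_distrib, hcol]
      simp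
      field_simp
    rw [e, abs_div, abs_of_nonneg (Nat.cast_nonneg m : (0 : ℝ) ≤ m), div_le_iff₀ (by positivity)]
    calc |∑ l, ((A ^ n) i j - (A ^ n) l j)| ≤ ∑ l : Fin m, (1 - ε) ^ (n / N) := by
          refine (Finset.abs_sum_le_sum_abs _ _).trans (Finset.sum_le_sum fun l _ => ?_)
          have := hosc (n / N) (n % N) i l
          rwa [Nat.div_add_mod] at this
      _ = (1 - ε) ^ (n / N) * m := by simp [mul_comm]
  -- If N = 0, then n / N = 0 and the bound is void; but positivity of all entries of A^0 = 1 forces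
  -- a single agent.
  rcases hN0 with h0 | hpos
  · have h1 : ∀ i j : Fin m, i = j := by
      intro i j
      by_contra hne
      have := hN i j
      simp [h0, hne] at this
    have hsub : Subsingleton (Fin m) := ⟨h1⟩
    have hm1 : m = 1 := by
      have := Fintype.card_le_one_iff_subsingleton.2 hsub
      have := Fin.pos i
      simp at *
      omega
    have : ∀ n, (A ^ n) i j = 1 := by
      intro n
      rw [← Matrix.sum_row_of_mem_rowStochastic (hst n) i, Fintype.sum_eq_single j]
      intro l hl
      exact absurd (h1 l j) hl
    simp [this, hm1]
  · rw [tendsto_iff_norm_sub_tendsto_zero]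
    refine squeeze_zero (fun _ => norm_nonneg _) hbound ?_
    exact (tendsto_pow_atTop_nhds_zero_of_lt_one (by linarith) (by linarith)).comp
      (Nat.tendsto_div_const_atTop hpos.ne')

end MatrixPowers

/-! ### Convergence in probability as convergence along a filter -/

section InProbability

variable {Ω : Type*} [MeasurableSpace Ω]

/-- The filter on `ℕ × Ω` of the families of events whose probability tends to one. Convergence
along it is convergence in probability. -/
def inProb (P : Measure Ω) : Filter (ℕ × Ω) where
  sets := {U | Tendsto (fun t => P {ω | (t, ω) ∉ U}) atTop (𝓝 0)}
  univ_sets := by simp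
  sets_of_superset {U V} hU hUV := by
    refine tendsto_of_tendsto_of_tendsto_of_le_of_le tendsto_const_nhds hU (fun _ => zero_le)
      fun t => measure_mono fun ω hω h => hω (hUV h)
  inter_sets {U V} hU hV := by
    have h := Tendsto.add (show Tendsto _ _ _ from hU) (show Tendsto _ _ _ from hV)
    rw [add_zero] at h
    refine tendsto_of_tendsto_of_tendsto_of_le_of_le tendsto_const_nhds h (fun _ => zero_le)
      fun t => (measure_mono ?_).trans (measure_union_le _ _)
    intro ω hω
    by_contra hcon
    simp only [Set.mem_union, Set.mem_ofPred_eq, not_or, not_not] at hcon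
    exact hω hcon

variable {P : Measure Ω}

lemma eventually_inProb {p : ℕ × Ω → Prop} :
    (∀ᶠ z in inProb P, p z) ↔ Tendsto (fun t => P {ω | ¬ p (t, ω)}) atTop (𝓝 0) := Iff.rfl

lemma tendsto_fst_inProb : Tendsto (Prod.fst : ℕ × Ω → ℕ) (inProb P) atTop := by
  refine tendsto_atTop.2 fun N => eventually_inProb.2 ?_
  refine tendsto_const_nhds.congr' ?_
  filter_upwards [eventually_ge_atTop N] with t ht
  simp [ht]

lemma tendsto_inProb_of_tendstoInMeasure {F : Type*} [PseudoEMetricSpace F] {f : ℕ → Ω → F}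
    {c : F} (h : TendstoInMeasure P f atTop (fun _ => c)) :
    Tendsto (fun z : ℕ × Ω => f z.1 z.2) (inProb P) (𝓝 c) := by
  refine EMetric.tendsto_nhds.2 fun ε hε => eventually_inProb.2 ?_
  simpa using h ε hε

lemma tendstoInMeasure_of_tendsto_inProb {F : Type*} [PseudoEMetricSpace F] {f : ℕ → Ω → F}
    {c : F} (h : Tendsto (fun z : ℕ × Ω => f z.1 z.2) (inProb P) (𝓝 c)) :
    TendstoInMeasure P f atTop (fun _ => c) := by
  intro ε hε
  have := eventually_inProb.1 (EMetric.tendsto_nhds.1 h ε hε)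
  simpa using this

end InProbability

/-! ### Laws of large numbers with uniform and with network weights -/

section LawOfLargeNumbers

/-- Pairs of an observation time below `t` and an agent. -/
def obsIndex (m t : ℕ) : Finset (ℕ × Fin m) := Finset.range t ×ˢ Finset.univ

/-- The weight that agent `j` gives at time `t` to an observation. -/
def agentWeight {m : ℕ} (A : Matrix (Fin m) (Fin m) ℝ) (t : ℕ) (j : Fin m) (a : ℕ × Fin m) : ℝ :=
  (A ^ (t - (a.1 + 1))) j a.2

variable {m : ℕ} {A : Matrix (Fin m) (Fin m) ℝ} {Ω : Type*} [MeasurableSpace Ω] {P : Measure Ω}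
  {𝓩 : Type*} [MeasurableSpace 𝓩] {ν : Measure 𝓩}
  {Z : Fin m → ℕ → Ω → 𝓩}

lemma sum_obsIndex {M : Type*} [AddCommMonoid M] (t : ℕ) (f : ℕ × Fin m → M) :
    ∑ a ∈ obsIndex m t, f a = ∑ k ∈ Finset.range t, ∑ i, f (k, i) :=
  Finset.sum_product _ _ _

lemma agentWeight_nonneg {G : SimpleGraph (Fin m)} (hA : IsCommunicationMatrix G A) (t : ℕ)
    (j : Fin m) (a : ℕ × Fin m) : 0 ≤ agentWeight A t j a :=
  Matrix.nonneg_of_mem_rowStochastic (pow_mem hA.stochastic _)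

lemma integral_comp_obs (hZ : ∀ i k, Measurable (Z i k)) (hlaw : ∀ i k, P.map (Z i k) = ν)
    {f : 𝓩 → ℝ} (hf : Measurable f) (i : Fin m) (k : ℕ) :
    ∫ ω, f (Z i k ω) ∂P = ∫ z, f z ∂ν := by
  rw [← hlaw i k, integral_map (hZ i k).aemeasurable hf.aestronglyMeasurable]

lemma integrable_comp_obs (hZ : ∀ i k, Measurable (Z i k)) (hlaw : ∀ i k, P.map (Z i k) = ν)
    {f : 𝓩 → ℝ} (hf : Measurable f) (hfi : Integrable f ν) (i : Fin m) (k : ℕ) :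
    Integrable (fun ω => f (Z i k ω)) P := by
  rw [← hlaw i k] at hfi
  exact (integrable_map_measure hf.aestronglyMeasurable (hZ i k).aemeasurable).1 hfi

lemma ae_tendsto_agent_average (hZ : ∀ i k, Measurable (Z i k))
    (hlaw : ∀ i k, P.map (Z i k) = ν)
    (hindep : iIndepFun (fun (ik : Fin m × ℕ) ω => Z ik.1 ik.2 ω) P)
    {f : 𝓩 → ℝ} (hf : Measurable f) (hfi : Integrable f ν) (i : Fin m) :
    ∀ᵐ ω ∂P, Tendsto (fun t : ℕ => (∑ k ∈ Finset.range t, f (Z i k ω)) / t) atTop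
      (𝓝 (∫ z, f z ∂ν)) := by
  have hpair : Pairwise fun k l => IndepFun (fun ω => f (Z i k ω)) (fun ω => f (Z i l ω)) P := by
    intro k l hkl
    have hkl' : (i, k) ≠ (i, l) := fun h => hkl (Prod.ext_iff.1 h).2
    have h : IndepFun (fun ω => Z i k ω) (fun ω => Z i l ω) P := hindep.indepFun hkl'
    exact h.comp hf hf
  have hident : ∀ k, IdentDistrib (fun ω => f (Z i k ω)) (fun ω => f (Z i 0 ω)) P P := by
    intro k
    have h : IdentDistrib (Z i k) (Z i 0) P P :=
      ⟨(hZ i k).aemeasurable, (hZ i 0).aemeasurable, by rw [hlaw, hlaw]⟩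
    exact h.comp hf
  have := strong_law_ae_real (μ := P) (fun k ω => f (Z i k ω))
    (integrable_comp_obs hZ hlaw hf hfi i 0) hpair hident
  rwa [integral_comp_obs hZ hlaw hf] at this

lemma tendsto_uniform_average [IsProbabilityMeasure P] [NeZero m] (hZ : ∀ i k, Measurable (Z i k))
    (hlaw : ∀ i k, P.map (Z i k) = ν)
    (hindep : iIndepFun (fun (ik : Fin m × ℕ) ω => Z ik.1 ik.2 ω) P)
    {f : 𝓩 → ℝ} (hf : Measurable f) (hfi : Integrable f ν) :
    Tendsto (fun z : ℕ × Ω => (z.1 : ℝ)⁻¹ * ∑ a ∈ obsIndex m z.1, (1 / m : ℝ) * f (Z a.2 a.1 z.2))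
      (inProb P) (𝓝 (∫ z, f z ∂ν)) := by
  have hae : ∀ᵐ ω ∂P, Tendsto (fun t : ℕ => (t : ℝ)⁻¹ *
      ∑ a ∈ obsIndex m t, (1 / m : ℝ) * f (Z a.2 a.1 ω)) atTop (𝓝 (∫ z, f z ∂ν)) := by
    filter_upwards [ae_all_iff.2 fun i => ae_tendsto_agent_average hZ hlaw hindep hf hfi i] with ω hω
    have h := (tendsto_finsetSum (Finset.univ : Finset (Fin m)) fun i _ => hω i).const_mul
      (1 / m : ℝ)
    have hm : (m : ℝ) ≠ 0 := Nat.cast_ne_zero.2 (NeZero.ne m)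
    have e : (1 / m : ℝ) * ∑ _i : Fin m, ∫ z, f z ∂ν = ∫ z, f z ∂ν := by
      simp
      field_simp
    rw [e] at h
    refine h.congr fun t => ?_
    rw [sum_obsIndex, Finset.sum_comm, ← Finset.sum_div, div_eq_inv_mul]
    simp only [← Finset.mul_sum]
    ring
  refine tendsto_inProb_of_tendstoInMeasure (f := fun (t : ℕ) ω => (t : ℝ)⁻¹ *
    ∑ a ∈ obsIndex m t, (1 / m : ℝ) * f (Z a.2 a.1 ω))
    (tendstoInMeasure_of_tendsto_ae (fun t => ?_) hae)
  refine Measurable.aestronglyMeasurable ?_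
  refine (Finset.measurable_fun_sum _ fun a _ => ?_).const_mul _
  exact (hf.comp (hZ _ _)).const_mul _

/-- The weights are split into 1/m and a remainder. The uniform part obeys the strong law; the
remainder tends to zero in L¹ because its weights are Cesàro negligible, so no variance is needed.
-/
lemma tendsto_weighted_average [IsProbabilityMeasure P] {G : SimpleGraph (Fin m)} (hA : IsCommunicationMatrix G A)
    (hZ : ∀ i k, Measurable (Z i k)) (hlaw : ∀ i k, P.map (Z i k) = ν)
    (hindep : iIndepFun (fun (ik : Fin m × ℕ) ω => Z ik.1 ik.2 ω) P)
    {f : 𝓩 → ℝ} (hf : Measurable f) (hfi : Integrable f ν) (j : Fin m) :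
    Tendsto (fun z : ℕ × Ω => (z.1 : ℝ)⁻¹ *
      ∑ a ∈ obsIndex m z.1, agentWeight A z.1 j a * f (Z a.2 a.1 z.2))
      (inProb P) (𝓝 (∫ z, f z ∂ν)) := by
  have : NeZero m := ⟨(Fin.pos j).ne'⟩
  set D : ℕ → Ω → ℝ := fun t ω => (t : ℝ)⁻¹ *
    ∑ a ∈ obsIndex m t, (agentWeight A t j a - 1 / m) * f (Z a.2 a.1 ω) with hD
  have hDint : ∀ t, Integrable (D t) P := fun t =>
    (integrable_finsetSum _ fun a _ =>
      (integrable_comp_obs hZ hlaw hf hfi a.2 a.1).const_mul _).const_mul _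
  set c : Fin m → ℕ → ℝ := fun i n => |(A ^ n) j i - 1 / m| with hc
  have hbound : ∀ t, ∫ ω, ‖D t ω‖ ∂P ≤
      (∫ z, |f z| ∂ν) * ∑ i, ((t : ℝ)⁻¹ * ∑ k ∈ Finset.range t, c i k) := by
    intro t
    calc ∫ ω, ‖D t ω‖ ∂P ≤ ∫ ω, (t : ℝ)⁻¹ *
          ∑ a ∈ obsIndex m t, |agentWeight A t j a - 1 / m| * |f (Z a.2 a.1 ω)| ∂P := by
          refine integral_mono (hDint t).norm ?_ fun ω => ?_
          · exact (integrable_finsetSum _ fun a _ =>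
              (integrable_comp_obs hZ hlaw hf hfi a.2 a.1).abs.const_mul _).const_mul _
          · simp only [hD, Real.norm_eq_abs, abs_mul]
            rw [abs_of_nonneg (by positivity : (0 : ℝ) ≤ (t : ℝ)⁻¹)]
            refine mul_le_mul_of_nonneg_left ?_ (by positivity)
            refine (Finset.abs_sum_le_sum_abs _ _).trans_eq ?_
            simp only [abs_mul]
      _ = (t : ℝ)⁻¹ * ∑ a ∈ obsIndex m t, |agentWeight A t j a - 1 / m| * ∫ z, |f z| ∂ν := by
          rw [integral_const_mul, integral_finsetSum]
          · simp only [integral_const_mul]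
            congr 1
            refine Finset.sum_congr rfl fun a _ => ?_
            rw [integral_comp_obs (f := fun z => |f z|) hZ hlaw hf.abs]
          · exact fun a _ => (integrable_comp_obs hZ hlaw hf hfi a.2 a.1).abs.const_mul _
      _ = _ := by
          rw [← Finset.sum_mul, sum_obsIndex, Finset.sum_comm, ← Finset.mul_sum]
          have : ∀ i : Fin m, ∑ k ∈ Finset.range t, |agentWeight A t j (k, i) - 1 / m| =
              ∑ k ∈ Finset.range t, c i k := by
            intro i
            -- Reversing time turns the exponent t - (k + 1) into k, so the bound becomes an honest
            -- Cesàro mean of a null sequence.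
            rw [← Finset.sum_range_reflect]
            refine Finset.sum_congr rfl fun k hk => ?_
            have : t - (t - 1 - k + 1) = k := by
              have := Finset.mem_range.1 hk
              omega
            simp only [hc, agentWeight, this]
          simp only [this]
          ring
  have hlim : Tendsto (fun t => ∫ ω, ‖D t ω‖ ∂P) atTop (𝓝 0) := by
    have h : ∀ i, Tendsto (fun t : ℕ => (t : ℝ)⁻¹ * ∑ k ∈ Finset.range t, c i k) atTop (𝓝 0) := by
      intro i
      refine Filter.Tendsto.cesaro ?_
      have := ((tendsto_pow_apply hA j i).sub_const (1 / m : ℝ)).abs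
      simpa [hc] using this
    have h2 := (tendsto_finsetSum (Finset.univ : Finset (Fin m)) fun i _ => h i).const_mul
      (∫ z, |f z| ∂ν)
    simp only [Finset.sum_const_zero, mul_zero] at h2
    exact squeeze_zero (fun t => integral_nonneg fun ω => norm_nonneg _) hbound h2
  have hD0 : Tendsto (fun z : ℕ × Ω => D z.1 z.2) (inProb P) (𝓝 0) := by
    refine tendsto_inProb_of_tendstoInMeasure
      (tendstoInMeasure_of_tendsto_eLpNorm (p := 1) one_ne_zero
        (fun t => (hDint t).aestronglyMeasurable) aestronglyMeasurable_const ?_)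
    have e : ∀ t, eLpNorm (D t - fun _ => (0 : ℝ)) 1 P = ENNReal.ofReal (∫ ω, ‖D t ω‖ ∂P) := by
      intro t
      rw [eLpNorm_one_eq_lintegral_enorm, ofReal_integral_norm_eq_lintegral_enorm (hDint t)]
      simp
    simp only [e]
    simpa using ENNReal.tendsto_ofReal hlim
  have h := hD0.add (tendsto_uniform_average hZ hlaw hindep hf hfi)
  rw [zero_add] at h
  refine h.congr fun z => ?_
  simp only [hD]
  rw [← mul_add, ← Finset.sum_add_distrib]
  congr 1
  refine Finset.sum_congr rfl fun a _ => ?_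
  ring

end LawOfLargeNumbers

/-! ### The logistic model: marginals, moments and Gibbs' inequality -/

section PairLaw

variable {p : ℕ}

local notation "𝔼" => EuclideanSpace ℝ (Fin p)

/-- The response as a real number. -/
def resp (y : Fin 2) : ℝ := ((y : ℕ) : ℝ)

lemma abs_resp_le (y : Fin 2) : |resp y| ≤ 1 := by
  fin_cases y <;> simp [resp]

lemma condProb_pos (θ x : 𝔼) (y : Fin 2) : 0 < condProb θ x y := Real.exp_pos _

lemma log_condProb (θ x : 𝔼) (y : Fin 2) :
    Real.log (condProb θ x y) = resp y * inner ℝ θ x - softplus (inner ℝ θ x) := by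
  rw [condProb, Real.log_exp, real_inner_smul_right]
  rfl

lemma sum_condProb (θ x : 𝔼) : ∑ y, condProb θ x y = 1 := by
  have h : 0 < 1 + Real.exp (inner ℝ θ x) := by positivity
  simp only [Fin.sum_univ_two, condProb, softplus, Real.exp_sub, Real.exp_log h]
  simp
  field_simp

lemma condProb_le_one (θ x : 𝔼) (y : Fin 2) : condProb θ x y ≤ 1 := by
  rw [← sum_condProb θ x]
  exact Finset.single_le_sum (fun y _ => (condProb_pos θ x y).le) (Finset.mem_univ y)

lemma measurable_condProb (θ : 𝔼) : Measurable fun z : 𝔼 × Fin 2 => condProb θ z.1 z.2 := by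
  refine measurable_from_prod_countable_left fun y => ?_
  have : Continuous fun x : 𝔼 => condProb θ x y := by
    unfold condProb
    have h1 : Continuous fun x : 𝔼 => (inner ℝ θ x : ℝ) := by fun_prop
    have h2 : Continuous fun x : 𝔼 => (inner ℝ θ ((y : ℝ) • x) : ℝ) := by fun_prop
    exact Real.continuous_exp.comp (h2.sub (continuous_softplus.comp h1))
  exact this.measurable

variable {μ : Measure (EuclideanSpace ℝ (Fin p))}

lemma lintegral_pairLaw [SFinite μ] (θ : 𝔼) {f : 𝔼 × Fin 2 → ℝ≥0∞} (hf : Measurable f) :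
    ∫⁻ z, f z ∂(pairLaw μ θ) =
      ∫⁻ x, ∑ y, ENNReal.ofReal (condProb θ x y) * f (x, y) ∂μ := by
  have hm : Measurable fun z : 𝔼 × Fin 2 => ENNReal.ofReal (condProb θ z.1 z.2) :=
    (measurable_condProb θ).ennreal_ofReal
  rw [pairLaw, lintegral_withDensity_eq_lintegral_mul _ hm hf, lintegral_prod _ (hm.mul hf).aemeasurable]
  refine lintegral_congr fun x => ?_
  rw [lintegral_count, tsum_fintype]
  rfl

variable [IsProbabilityMeasure μ]

lemma map_fst_pairLaw (θ : 𝔼) : (pairLaw μ θ).map Prod.fst = μ := by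
  ext s hs
  rw [Measure.map_apply measurable_fst hs, ← lintegral_indicator_one (measurable_fst hs),
    lintegral_pairLaw θ (measurable_one.indicator (measurable_fst hs)),
    ← lintegral_indicator_one hs]
  refine lintegral_congr fun x => ?_
  by_cases hx : x ∈ s
  · simp only [Set.indicator, Set.mem_preimage, hx, if_true, Pi.one_apply, mul_one]
    rw [← ENNReal.ofReal_sum_of_nonneg fun y _ => (condProb_pos θ x y).le, sum_condProb]
    simp
  · simp [Set.indicator, hx]

instance isProbabilityMeasure_pairLaw (θ : 𝔼) : IsProbabilityMeasure (pairLaw μ θ) := by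
  refine ⟨?_⟩
  rw [← Set.preimage_univ (f := Prod.fst), ← Measure.map_apply measurable_fst MeasurableSet.univ,
    map_fst_pairLaw, measure_univ]

lemma integrable_comp_fst_pairLaw (θ : 𝔼) {f : 𝔼 → ℝ} (hf : Integrable f μ) :
    Integrable (fun z => f z.1) (pairLaw μ θ) := by
  rw [← map_fst_pairLaw (μ := μ) θ] at hf
  exact hf.comp_measurable measurable_fst

lemma integral_comp_fst_pairLaw (θ : 𝔼) {f : 𝔼 → ℝ} (hf : Measurable f) :
    ∫ z, f z.1 ∂(pairLaw μ θ) = ∫ x, f x ∂μ := by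
  conv_rhs => rw [← map_fst_pairLaw (μ := μ) θ]
  rw [integral_map measurable_fst.aemeasurable hf.aestronglyMeasurable]

/-- Since σ(-η) = σ(η) - η, the difference is ⟨θ, x⟩ for response 0 and -⟨θ, x⟩ for response 1.
Integrable log-likelihoods thus control every linear functional of the covariate. -/
lemma abs_log_condProb_neg_sub (θ x : 𝔼) (y : Fin 2) :
    |Real.log (condProb (-θ) x y) - Real.log (condProb θ x y)| = |(inner ℝ θ x : ℝ)| := by
  rw [log_condProb, log_condProb, inner_neg_left, softplus_neg]
  fin_cases y
  · simp [resp]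
  · simp only [resp]
    rw [← abs_neg]
    congr 1
    simp
    ring

omit [IsProbabilityMeasure μ] in
lemma integrable_norm_fst_pairLaw {θ₀ : 𝔼}
    (hlog : ∀ θ, Integrable (fun z : 𝔼 × Fin 2 => Real.log (condProb θ z.1 z.2)) (pairLaw μ θ₀)) :
    Integrable (fun z : 𝔼 × Fin 2 => ‖z.1‖) (pairLaw μ θ₀) := by
  have hin : ∀ θ : 𝔼, Integrable (fun z : 𝔼 × Fin 2 => |(inner ℝ θ z.1 : ℝ)|) (pairLaw μ θ₀) := by
    intro θ
    refine ((hlog (-θ)).sub (hlog θ)).abs.congr (Eventually.of_forall fun z => ?_)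
    exact abs_log_condProb_neg_sub θ z.1 z.2
  have hsum := integrable_finsetSum (Finset.univ : Finset (Fin p))
    fun a _ => hin (EuclideanSpace.single a 1)
  refine hsum.mono' measurable_fst.norm.aestronglyMeasurable (Eventually.of_forall fun z => ?_)
  have h : z.1 = ∑ a, z.1 a • EuclideanSpace.single a (1 : ℝ) := by
    have := (EuclideanSpace.basisFun (Fin p) ℝ).sum_repr z.1
    simpa using this.symm
  rw [norm_norm]
  conv_lhs => rw [h]
  refine (norm_sum_le _ _).trans (Finset.sum_le_sum fun a _ => ?_)
  simp [norm_smul, EuclideanSpace.inner_single_left]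

/-- Gibbs' inequality: the expected log-likelihood is strictly maximal at the truth. -/
lemma integral_log_condProb_lt {θ₀ θ : 𝔼}
    (hlog : ∀ θ, Integrable (fun z : 𝔼 × Fin 2 => Real.log (condProb θ z.1 z.2)) (pairLaw μ θ₀))
    (hne : pairLaw μ θ ≠ pairLaw μ θ₀) :
    ∫ z, Real.log (condProb θ z.1 z.2) ∂(pairLaw μ θ₀) <
      ∫ z, Real.log (condProb θ₀ z.1 z.2) ∂(pairLaw μ θ₀) := by
  -- The likelihood ratio has mean one under the truth. If the claim failed, the nonnegative
  -- function r - 1 - log r would have integral zero, hence r = 1 almost everywhere and the two laws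
  -- would agree.
  set r : 𝔼 × Fin 2 → ℝ := fun z => condProb θ z.1 z.2 / condProb θ₀ z.1 z.2 with hr
  have hrm : Measurable r := (measurable_condProb θ).div (measurable_condProb θ₀)
  have hrpos : ∀ z, 0 < r z := fun z => div_pos (condProb_pos _ _ _) (condProb_pos _ _ _)
  have hdens : (pairLaw μ θ₀).withDensity (fun z => ENNReal.ofReal (r z)) = pairLaw μ θ := by
    rw [pairLaw, ← withDensity_mul _ (measurable_condProb θ₀).ennreal_ofReal hrm.ennreal_ofReal,
      pairLaw]
    congr 1
    ext z
    rw [Pi.mul_apply, ← ENNReal.ofReal_mul (condProb_pos _ _ _).le, hr]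
    simp only
    rw [mul_div_cancel₀ _ (condProb_pos _ _ _).ne']
  have hlint : ∫⁻ z, ENNReal.ofReal (r z) ∂(pairLaw μ θ₀) = 1 := by
    have := congrArg (fun ρ : Measure (𝔼 × Fin 2) => ρ Set.univ) hdens
    simpa using this
  have hrint : Integrable r (pairLaw μ θ₀) := by
    refine ⟨hrm.aestronglyMeasurable, ?_⟩
    rw [hasFiniteIntegral_iff_ofReal (Eventually.of_forall fun z => (hrpos z).le), hlint]
    exact ENNReal.one_lt_top
  have hr1 : ∫ z, r z ∂(pairLaw μ θ₀) = 1 := by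
    rw [integral_eq_lintegral_of_nonneg_ae (Eventually.of_forall fun z => (hrpos z).le)
      hrm.aestronglyMeasurable, hlint, ENNReal.toReal_one]
  have hlogr : ∀ z : 𝔼 × Fin 2, Real.log (r z) =
      Real.log (condProb θ z.1 z.2) - Real.log (condProb θ₀ z.1 z.2) := fun z =>
    Real.log_div (condProb_pos _ _ _).ne' (condProb_pos _ _ _).ne'
  have hlogint : Integrable (fun z => Real.log (r z)) (pairLaw μ θ₀) := by
    simp only [hlogr]
    exact (hlog θ).sub (hlog θ₀)
  by_contra hcon
  push Not at hcon
  have hge : 0 ≤ ∫ z, Real.log (r z) ∂(pairLaw μ θ₀) := by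
    simp only [hlogr]
    rw [integral_sub (hlog θ) (hlog θ₀)]
    linarith
  have hnn : ∀ z, 0 ≤ r z - 1 - Real.log (r z) := fun z => by
    linarith [Real.log_le_sub_one_of_pos (hrpos z)]
  have hint0 : Integrable (fun z => r z - 1 - Real.log (r z)) (pairLaw μ θ₀) :=
    (hrint.sub (integrable_const 1)).sub hlogint
  have hzero : ∫ z, (r z - 1 - Real.log (r z)) ∂(pairLaw μ θ₀) = 0 := by
    refine le_antisymm ?_ (integral_nonneg hnn)
    have h1 : ∫ z, (r z - 1) ∂(pairLaw μ θ₀) = 0 := by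
      rw [integral_sub hrint (integrable_const 1), hr1]
      simp
    have h2 : Integrable (fun z => r z - 1) (pairLaw μ θ₀) := hrint.sub (integrable_const 1)
    rw [integral_sub h2 hlogint, h1]
    simpa using hge
  have hae := (integral_eq_zero_iff_of_nonneg hnn hint0).1 hzero
  apply hne
  rw [← hdens]
  conv_rhs => rw [← withDensity_one (μ := pairLaw μ θ₀)]
  refine withDensity_congr_ae ?_
  filter_upwards [hae] with z hz
  have h1 : r z = 1 := by
    by_contra h
    have := Real.log_lt_sub_one_of_pos (hrpos z) h
    simp only [Pi.zero_apply] at hz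
    linarith
  simp [h1]

end PairLaw

/-! ### Normalization of L¹ convergent densities -/

section Normalization

lemma tendsto_integral_of_tendsto_integral_abs_sub {ι E : Type*} [MeasurableSpace E]
    {ρ : Measure E} {l : Filter ι} {F : ι → E → ℝ} {f : E → ℝ} (hF : ∀ᶠ n in l, Integrable (F n) ρ)
    (hf : Integrable f ρ) (hlim : Tendsto (fun n => ∫ h, |F n h - f h| ∂ρ) l (𝓝 0)) :
    Tendsto (fun n => ∫ h, F n h ∂ρ) l (𝓝 (∫ h, f h ∂ρ)) := by
  rw [tendsto_iff_norm_sub_tendsto_zero]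
  refine squeeze_zero' (Eventually.of_forall fun n => norm_nonneg _) ?_ hlim
  filter_upwards [hF] with n hn
  rw [← integral_sub hn hf]
  exact norm_integral_le_integral_norm _

/-- Convergence in `L¹` is preserved by normalization. -/
lemma tendsto_integral_abs_normalized_sub {ι E : Type*} [MeasurableSpace E]
    {ρ : Measure E} {l : Filter ι} {F : ι → E → ℝ} {f : E → ℝ} (hF : ∀ᶠ n in l, Integrable (F n) ρ)
    (hf : Integrable f ρ) (hpos : 0 < ∫ h, f h ∂ρ)
    (hlim : Tendsto (fun n => ∫ h, |F n h - f h| ∂ρ) l (𝓝 0)) :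
    Tendsto (fun n => ∫ h, |(∫ h, F n h ∂ρ)⁻¹ * F n h - (∫ h, f h ∂ρ)⁻¹ * f h| ∂ρ) l (𝓝 0) := by
  have hI := (tendsto_integral_of_tendsto_integral_abs_sub hF hf hlim).inv₀ hpos.ne'
  have h1 := hI.abs.mul hlim
  have h2 := (hI.sub_const (∫ h, f h ∂ρ)⁻¹).abs.mul_const (∫ h, |f h| ∂ρ)
  have h3 := h1.add h2
  simp only [mul_zero, sub_self, abs_zero, zero_mul, add_zero] at h3
  refine squeeze_zero' (Eventually.of_forall fun n => integral_nonneg fun h => abs_nonneg _) ?_ h3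
  filter_upwards [hF] with n hn
  set a := (∫ h, F n h ∂ρ)⁻¹
  set b := (∫ h, f h ∂ρ)⁻¹
  have i1 : Integrable (fun h => |a| * |F n h - f h|) ρ := (hn.sub hf).abs.const_mul _
  have i2 : Integrable (fun h => |a - b| * |f h|) ρ := hf.abs.const_mul _
  rw [← integral_const_mul, ← integral_const_mul, ← integral_add i1 i2]
  refine integral_mono ((hn.const_mul a).sub (hf.const_mul b)).abs (i1.add i2) fun h => ?_
  simp only
  rw [← abs_mul, ← abs_mul]
  refine le_trans (le_of_eq ?_) (abs_add_le _ _)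
  congr 1
  ring

end Normalization

/-! ### Quadratic forms and Gaussian integrals -/

section QuadForm

variable {p : ℕ}

local notation "𝔼" => EuclideanSpace ℝ (Fin p)

/-- The quadratic form of a matrix. -/
noncomputable def quadForm (V : Matrix (Fin p) (Fin p) ℝ) (h : 𝔼) : ℝ :=
  h.ofLp ⬝ᵥ (V *ᵥ h.ofLp)

lemma quadForm_eq_sum (V : Matrix (Fin p) (Fin p) ℝ) (h : 𝔼) :
    quadForm V h = ∑ a, ∑ b, V a b * (h a * h b) := by
  simp only [quadForm, dotProduct, Matrix.mulVec, Finset.mul_sum]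
  refine Finset.sum_congr rfl fun a _ => Finset.sum_congr rfl fun b _ => ?_
  ring

lemma continuous_quadForm (V : Matrix (Fin p) (Fin p) ℝ) : Continuous (quadForm V) := by
  have : quadForm V = fun h : 𝔼 => ∑ a, ∑ b, V a b * (h a * h b) := funext (quadForm_eq_sum V)
  rw [this]
  fun_prop

lemma quadForm_smul (V : Matrix (Fin p) (Fin p) ℝ) (s : ℝ) (h : 𝔼) :
    quadForm V (s • h) = s ^ 2 * quadForm V h := by
  simp only [quadForm_eq_sum, Finset.mul_sum]
  refine Finset.sum_congr rfl fun a _ => Finset.sum_congr rfl fun b _ => ?_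
  simp
  ring

lemma abs_apply_le_norm (h : 𝔼) (a : Fin p) : |h a| ≤ ‖h‖ := PiLp.norm_apply_le h a

lemma abs_quadForm_sub_le (V V' : Matrix (Fin p) (Fin p) ℝ) (h : 𝔼) :
    |quadForm V h - quadForm V' h| ≤ (∑ a, ∑ b, |V a b - V' a b|) * ‖h‖ ^ 2 := by
  simp only [quadForm_eq_sum, ← Finset.sum_sub_distrib, Finset.sum_mul]
  refine (Finset.abs_sum_le_sum_abs _ _).trans (Finset.sum_le_sum fun a _ => ?_)
  refine (Finset.abs_sum_le_sum_abs _ _).trans (Finset.sum_le_sum fun b _ => ?_)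
  rw [← sub_mul, abs_mul, abs_mul, sq]
  gcongr <;> exact abs_apply_le_norm _ _

lemma quadForm_pos {V : Matrix (Fin p) (Fin p) ℝ} (hV : V.PosDef) {h : 𝔼} (hh : h ≠ 0) :
    0 < quadForm V h := by
  have : h.ofLp ≠ 0 := fun e => hh (by ext a; simp [e])
  simpa [quadForm] using hV.dotProduct_mulVec_pos this

lemma posDef_of_quadForm_pos {V : Matrix (Fin p) (Fin p) ℝ} (hV : V.IsHermitian)
    (h : ∀ u : 𝔼, u ≠ 0 → 0 < quadForm V u) : V.PosDef := by
  refine Matrix.PosDef.of_dotProduct_mulVec_pos hV fun v hv => ?_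
  have := h (WithLp.toLp 2 v) (fun e => hv (by simpa using congrArg WithLp.ofLp e))
  simpa [quadForm] using this

lemma exists_coercive {V : Matrix (Fin p) (Fin p) ℝ} (hV : V.PosDef) :
    ∃ c : ℝ, 0 < c ∧ ∀ h : 𝔼, c * ‖h‖ ^ 2 ≤ quadForm V h := by
  -- The unit sphere is empty exactly when p = 0, where any constant works; otherwise c is the
  -- minimum of the form on it.
  rcases (Metric.sphere (0 : 𝔼) 1).eq_empty_or_nonempty with hE | hE
  · refine ⟨1, one_pos, fun h => ?_⟩
    have : h = 0 := by
      by_contra hh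
      have : (‖h‖⁻¹ • h) ∈ Metric.sphere (0 : 𝔼) 1 := by simp [norm_smul, hh]
      rw [hE] at this
      exact this
    subst this
    simp [quadForm]
  · obtain ⟨v, hv, hmin⟩ := (isCompact_sphere (0 : 𝔼) 1).exists_isMinOn hE
      (continuous_quadForm V).continuousOn
    have hv1 : ‖v‖ = 1 := by simpa using hv
    refine ⟨quadForm V v, quadForm_pos hV (norm_ne_zero_iff.1 (by rw [hv1]; norm_num)), fun h => ?_⟩
    by_cases hh : h = 0
    · subst hh
      simp [quadForm]
    · have hn : 0 < ‖h‖ := norm_pos_iff.2 hh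
      have : (‖h‖⁻¹ • h) ∈ Metric.sphere (0 : 𝔼) 1 := by simp [norm_smul, hh]
      have h1 : quadForm V v ≤ quadForm V (‖h‖⁻¹ • h) := hmin this
      rw [quadForm_smul] at h1
      calc quadForm V v * ‖h‖ ^ 2 ≤ (‖h‖⁻¹ ^ 2 * quadForm V h) * ‖h‖ ^ 2 := by gcongr
        _ = quadForm V h := by field_simp

lemma integral_exp_neg_mul_norm_sq_pos {b : ℝ} (hb : 0 < b) :
    0 < ∫ h : 𝔼, Real.exp (-b * ‖h‖ ^ 2) := by
  rw [GaussianFourier.integral_rexp_neg_mul_sq_norm hb]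
  positivity

/-- The Bochner integral of a nonintegrable function is zero by convention, so a nonzero value
certifies integrability. -/
lemma integrable_exp_neg_mul_norm_sq {b : ℝ} (hb : 0 < b) :
    Integrable fun h : 𝔼 => Real.exp (-b * ‖h‖ ^ 2) :=
  Integrable.of_integral_ne_zero (integral_exp_neg_mul_norm_sq_pos hb).ne'

lemma integrable_exp_quadForm {V : Matrix (Fin p) (Fin p) ℝ} (hV : V.PosDef) :
    Integrable fun h : 𝔼 => Real.exp (-quadForm V h / 2) := by
  obtain ⟨c, hc, hcV⟩ := exists_coercive hV
  refine (integrable_exp_neg_mul_norm_sq (p := p) (half_pos hc)).mono'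
    (Real.continuous_exp.comp ((continuous_quadForm V).neg.div_const 2)).aestronglyMeasurable
    (Eventually.of_forall fun h => ?_)
  rw [Real.norm_of_nonneg (Real.exp_pos _).le]
  exact Real.exp_le_exp.2 (by linarith [hcV h])

/-- Factoring V = Bᴴ B turns the form into ‖B h‖², and the linear substitution by B reduces to the
standard Gaussian integral, with Jacobian |det B| = √(det V). -/
lemma integral_exp_quadForm {V : Matrix (Fin p) (Fin p) ℝ} (hV : V.PosDef) :
    ∫ h : 𝔼, Real.exp (-quadForm V h / 2) = Real.sqrt ((2 * Real.pi) ^ p * V⁻¹.det) := by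
  obtain ⟨B, hB⟩ : ∃ B : Matrix (Fin p) (Fin p) ℝ, V = Bᴴ * B := by
    open scoped MatrixOrder in
    exact CStarAlgebra.nonneg_iff_eq_star_mul_self.mp hV.posSemidef.nonneg
  set f : 𝔼 →ₗ[ℝ] 𝔼 := Matrix.toLpLin 2 2 B with hf
  have hdet : LinearMap.det f = B.det := by
    rw [hf, Matrix.toLpLin_eq_toLin, LinearMap.det_toLin]
  have hVB : V.det = B.det ^ 2 := by
    rw [hB, Matrix.det_mul, Matrix.det_conjTranspose]
    simp [sq]
  have hBdet : B.det ≠ 0 := by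
    intro h
    have := hV.det_pos
    rw [hVB, h] at this
    simp at this
  have hq : ∀ h : 𝔼, quadForm V h = ‖f h‖ ^ 2 := by
    intro h
    rw [EuclideanSpace.real_norm_sq_eq, quadForm, hB, ← Matrix.mulVec_mulVec,
      Matrix.dotProduct_mulVec, Matrix.conjTranspose_eq_transpose_of_trivial,
      Matrix.vecMul_transpose]
    simp [dotProduct, hf, sq]
  have hfm : Continuous f := LinearMap.continuous_of_finiteDimensional f
  have hchange : ∫ h : 𝔼, Real.exp (-quadForm V h / 2) =
      |B.det|⁻¹ * ∫ v : 𝔼, Real.exp (-(1 / 2 : ℝ) * ‖v‖ ^ 2) := by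
    have h1 : ∫ v, Real.exp (-(1 / 2 : ℝ) * ‖v‖ ^ 2) ∂(Measure.map f (volume : Measure 𝔼)) =
        ∫ h : 𝔼, Real.exp (-(1 / 2 : ℝ) * ‖f h‖ ^ 2) :=
      integral_map hfm.measurable.aemeasurable (by fun_prop)
    rw [Measure.map_linearMap_addHaar_eq_smul_addHaar _ (by rw [hdet]; exact hBdet),
      integral_smul_measure, hdet] at h1
    rw [ENNReal.toReal_ofReal (abs_nonneg _), abs_inv, smul_eq_mul] at h1
    rw [h1]
    refine integral_congr_ae (Eventually.of_forall fun h => ?_)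
    simp only [hq]
    congr 1
    ring
  rw [hchange, GaussianFourier.integral_rexp_neg_mul_sq_norm (by norm_num), finrank_euclideanSpace,
    Fintype.card_fin]
  have h2 : Real.pi / (1 / 2) = 2 * Real.pi := by ring
  rw [h2, Real.sqrt_mul (by positivity), Matrix.det_nonsing_inv, hVB, Ring.inverse_eq_inv',
    Real.sqrt_inv, Real.sqrt_sq_eq_abs, mul_comm, Real.sqrt_eq_rpow, ← Real.rpow_natCast,
    ← Real.rpow_mul (by positivity)]
  congr 2
  ring

/-- The normal density with precision matrix `V` is the normalized exponential of its quadratic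
form. -/
lemma gaussianDensity_inv_eq {V : Matrix (Fin p) (Fin p) ℝ} (hV : V.PosDef) (h : 𝔼) :
    gaussianDensity V⁻¹ h =
      (∫ h : 𝔼, Real.exp (-quadForm V h / 2))⁻¹ * Real.exp (-quadForm V h / 2) := by
  rw [gaussianDensity, integral_exp_quadForm hV, Matrix.nonsing_inv_nonsing_inv _
    (isUnit_iff_ne_zero.2 hV.det_pos.ne')]
  rfl

lemma integral_exp_quadForm_pos {V : Matrix (Fin p) (Fin p) ℝ} (hV : V.PosDef) :
    0 < ∫ h : 𝔼, Real.exp (-quadForm V h / 2) := by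
  rw [integral_exp_quadForm hV]
  have := hV.inv.det_pos
  positivity

variable {ι : Type*} {l : Filter ι} {U : ι → Matrix (Fin p) (Fin p) ℝ}
  {V : Matrix (Fin p) (Fin p) ℝ}

lemma tendsto_sum_abs_sub (hU : ∀ a b, Tendsto (fun n => U n a b) l (𝓝 (V a b))) :
    Tendsto (fun n => ∑ a, ∑ b, |U n a b - V a b|) l (𝓝 0) := by
  have := tendsto_finsetSum (Finset.univ : Finset (Fin p)) fun a _ =>
    tendsto_finsetSum (Finset.univ : Finset (Fin p)) fun b _ => ((hU a b).sub_const (V a b)).abs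
  simpa using this

/-- Entrywise convergence is uniform relative to ‖h‖², so half of the coercivity constant survives.
This supplies both positive definiteness and a common Gaussian majorant. -/
lemma eventually_coercive (hU : ∀ a b, Tendsto (fun n => U n a b) l (𝓝 (V a b)))
    {c : ℝ} (hc : 0 < c) (hcV : ∀ h : 𝔼, c * ‖h‖ ^ 2 ≤ quadForm V h) :
    ∀ᶠ n in l, ∀ h : 𝔼, c / 2 * ‖h‖ ^ 2 ≤ quadForm (U n) h := by
  filter_upwards [(tendsto_sum_abs_sub hU).eventually_lt_const (half_pos hc)] with n hn h
  have h1 := (abs_le.1 (abs_quadForm_sub_le (U n) V h)).1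
  have h2 : (∑ a, ∑ b, |U n a b - V a b|) * ‖h‖ ^ 2 ≤ c / 2 * ‖h‖ ^ 2 := by gcongr
  linarith [hcV h]

lemma eventually_posDef (hV : V.PosDef) (hU : ∀ a b, Tendsto (fun n => U n a b) l (𝓝 (V a b)))
    (hsymm : ∀ n, (U n).IsHermitian) : ∀ᶠ n in l, (U n).PosDef := by
  obtain ⟨c, hc, hcV⟩ := exists_coercive hV
  filter_upwards [eventually_coercive hU hc hcV] with n hn
  refine posDef_of_quadForm_pos (hsymm n) fun u hu => lt_of_lt_of_le ?_ (hn u)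
  have := norm_pos_iff.2 hu
  positivity

lemma tendsto_integral_abs_exp_quadForm_sub [l.IsCountablyGenerated] (hV : V.PosDef)
    (hU : ∀ a b, Tendsto (fun n => U n a b) l (𝓝 (V a b))) :
    Tendsto (fun n => ∫ h : 𝔼, |Real.exp (-quadForm (U n) h / 2) - Real.exp (-quadForm V h / 2)|) l
      (𝓝 0) := by
  obtain ⟨c, hc, hcV⟩ := exists_coercive hV
  have hcont : ∀ W : Matrix (Fin p) (Fin p) ℝ,
      Continuous fun h : 𝔼 => Real.exp (-quadForm W h / 2) := fun W =>
    Real.continuous_exp.comp ((continuous_quadForm W).neg.div_const 2)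
  have hlim := tendsto_integral_filter_of_dominated_convergence (μ := (volume : Measure 𝔼)) (l := l)
    (F := fun n h => |Real.exp (-quadForm (U n) h / 2) - Real.exp (-quadForm V h / 2)|)
    (f := fun _ => 0)
    (fun h => Real.exp (-(c / 4) * ‖h‖ ^ 2) + Real.exp (-quadForm V h / 2))
    (Eventually.of_forall fun n => ((hcont _).sub (hcont _)).abs.aestronglyMeasurable) ?_
    ((integrable_exp_neg_mul_norm_sq (by positivity)).add (integrable_exp_quadForm hV)) ?_
  · simpa using hlim
  · filter_upwards [eventually_coercive hU hc hcV] with n hn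
    refine Eventually.of_forall fun h => ?_
    rw [Real.norm_of_nonneg (abs_nonneg _)]
    refine (abs_sub _ _).trans ?_
    rw [abs_of_pos (Real.exp_pos _), abs_of_pos (Real.exp_pos _)]
    gcongr
    linarith [hn h]
  · refine Eventually.of_forall fun h => ?_
    have h1 : Tendsto (fun n => quadForm (U n) h) l (𝓝 (quadForm V h)) := by
      simp only [quadForm_eq_sum]
      exact tendsto_finsetSum _ fun a _ => tendsto_finsetSum _ fun b _ => (hU a b).mul_const _
    have h2 := ((Real.continuous_exp.tendsto _).comp (h1.neg.div_const 2)).sub_const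
      (Real.exp (-quadForm V h / 2))
    simpa using h2.abs

end QuadForm

/-! ### Laplace's method for concave log-likelihoods -/

section Laplace

variable {p : ℕ}

local notation "𝔼" => EuclideanSpace ℝ (Fin p)

/-- Outside of a ball around its maximizer a concave function lies below the largest value that it
takes on the sphere. -/
lemma ConcaveOn.sub_le_of_sphere {M : 𝔼 → ℝ} (hM : ConcaveOn ℝ Set.univ M) {θ : 𝔼} {δ K : ℝ}
    (hδ : 0 < δ) (hK : 0 ≤ K) (hs : ∀ u : 𝔼, ‖u‖ = δ → M (θ + u) - M θ ≤ -K) {u : 𝔼}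
    (hu : δ ≤ ‖u‖) : M (θ + u) - M θ ≤ -K := by
  have hn : 0 < ‖u‖ := hδ.trans_le hu
  set r := δ / ‖u‖ with hr
  have hr0 : 0 < r := div_pos hδ hn
  have hr1 : r ≤ 1 := (div_le_one hn).2 hu
  have h1 := hs (r • u) (by
    rw [norm_smul, Real.norm_of_nonneg hr0.le, hr, div_mul_cancel₀ _ hn.ne'])
  have h2 := hM.2 (Set.mem_univ θ) (Set.mem_univ (θ + u)) (sub_nonneg.2 hr1) hr0.le (by ring)
  have e : (1 - r) • θ + r • (θ + u) = θ + r • u := by module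
  rw [e] at h2
  simp only [smul_eq_mul] at h2
  have h3 : r * (M (θ + u) - M θ) ≤ -K := by linarith
  nlinarith

variable {ι : Type*} {l : Filter ι}

lemma integrable_comp_add_smul {f : 𝔼 → ℝ} (hf : Integrable f) (θ : 𝔼) {s : ℝ} (hs : s ≠ 0) :
    Integrable fun h : 𝔼 => f (θ + s⁻¹ • h) :=
  (hf.comp_add_left θ).comp_smul (R := s⁻¹) (inv_ne_zero hs)

lemma integral_comp_add_smul (f : 𝔼 → ℝ) (θ : 𝔼) {s : ℝ} (hs : 0 ≤ s) :
    ∫ h : 𝔼, f (θ + s⁻¹ • h) = s ^ p * ∫ θ, f θ := by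
  rw [Measure.integral_comp_inv_smul_of_nonneg volume (fun x => f (θ + x)) hs,
    integral_add_left_eq_self, finrank_euclideanSpace, Fintype.card_fin, smul_eq_mul]

/-- The power of √t is the Jacobian of the local rescaling, which must lose against the
exponentially small tails. -/
lemma tendsto_sqrt_pow_mul_exp_neg {a : ℝ} (ha : 0 < a) (p : ℕ) :
    Tendsto (fun t : ℕ => Real.sqrt t ^ p * Real.exp (-a * t)) atTop (𝓝 0) := by
  have h := (tendsto_rpow_mul_exp_neg_mul_atTop_nhds_zero (p / 2 : ℝ) a ha).comp
    tendsto_natCast_atTop_atTop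
  refine h.congr fun t => ?_
  simp only [Function.comp_apply]
  rw [Real.sqrt_eq_rpow, ← Real.rpow_natCast, ← Real.rpow_mul (Nat.cast_nonneg t)]
  congr 2
  ring

/-- The unnormalized posterior density in the local coordinate `h = √t (θ - θ̂)`. -/
noncomputable def localDensity (M π : 𝔼 → ℝ) (t : ℕ) (θ h : 𝔼) : ℝ :=
  Real.exp (M (θ + (Real.sqrt t)⁻¹ • h) - M θ) * π (θ + (Real.sqrt t)⁻¹ • h)

lemma measurable_localDensity {M π : 𝔼 → ℝ} (hM : Continuous M) (hπ : Measurable π) (t : ℕ)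
    (θ : 𝔼) : Measurable (localDensity M π t θ) := by
  have h : Continuous fun h : 𝔼 => θ + (Real.sqrt t)⁻¹ • h := by fun_prop
  exact ((hM.comp h).sub continuous_const).rexp.measurable.mul (hπ.comp h.measurable)

lemma localDensity_nonneg {M π : 𝔼 → ℝ} (hπ : ∀ θ, 0 ≤ π θ) (t : ℕ) (θ h : 𝔼) :
    0 ≤ localDensity M π t θ h := mul_nonneg (Real.exp_pos _).le (hπ _)

/-- At a maximizer the likelihood ratio is at most one, so the rescaled prior density dominates. -/
lemma integrable_localDensity {M π : 𝔼 → ℝ} (hM : Continuous M) (hπm : Measurable π)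
    (hπ : ∀ θ, 0 ≤ π θ) (hπi : Integrable π) {t : ℕ} (ht : 0 < t) {θ : 𝔼}
    (hmax : ∀ θ', M θ' ≤ M θ) : Integrable (localDensity M π t θ) := by
  have hs : Real.sqrt t ≠ 0 := (Real.sqrt_pos.2 (Nat.cast_pos.2 ht)).ne'
  refine (integrable_comp_add_smul hπi θ hs).mono'
    (measurable_localDensity hM hπm t θ).aestronglyMeasurable (Eventually.of_forall fun h => ?_)
  rw [Real.norm_of_nonneg (localDensity_nonneg hπ t θ h)]
  refine mul_le_of_le_one_left (hπ _) (Real.exp_le_one_iff.2 ?_)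
  linarith [hmax (θ + (Real.sqrt t)⁻¹ • h)]

/-- Laplace approximation of a posterior density with concave log-likelihood. -/
theorem tendsto_integral_abs_localDensity_sub [l.IsCountablyGenerated] {t : ι → ℕ}
    (ht : Tendsto t l atTop) {M : ι → 𝔼 → ℝ} (hMcont : ∀ n, Continuous (M n))
    (hMconc : ∀ n, ConcaveOn ℝ Set.univ (M n)) {θ₀ : 𝔼} {θh : ι → 𝔼} (hθ : Tendsto θh l (𝓝 θ₀))
    (hmax : ∀ᶠ n in l, ∀ θ', M n θ' ≤ M n (θh n))
    {V : Matrix (Fin p) (Fin p) ℝ} (hV : V.PosDef) {η : ι → ℝ} (hη : Tendsto η l (𝓝 0)) {R : ℝ}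
    (hR : 0 ≤ R)
    (htaylor : ∀ᶠ n in l, ∀ u : 𝔼, |M n (θh n + u) - M n (θh n) + t n * quadForm V u / 2| ≤
      t n * (η n * ‖u‖ ^ 2 + R * ‖u‖ ^ 3))
    {π : 𝔼 → ℝ} (hπm : Measurable π) (hπ : ∀ θ, 0 ≤ π θ) (hπi : Integrable π)
    (hπc : ContinuousAt π θ₀) :
    Tendsto (fun n => ∫ h : 𝔼, |localDensity (M n) π (t n) (θh n) h -
      Real.exp (-quadForm V h / 2) * π θ₀|) l (𝓝 0) := by
  obtain ⟨c, hc, hcV⟩ := exists_coercive hV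
  obtain ⟨δ₁, hδ₁, hπδ⟩ := Metric.continuousAt_iff.1 hπc 1 one_pos
  -- The first bound keeps θh + u where π ≤ π θ₀ + 1 once θh is within δ₁ / 2 of θ₀. The second
  -- makes the cubic error at most c/8 ‖u‖²; with another c/8 for η, the exponent keeps c/2 - c/4 =
  -- c/4. Using R + 1 avoids division by zero.
  set δ : ℝ := min (δ₁ / 2) (c / (8 * (R + 1))) with hδd
  have hδ : 0 < δ := lt_min (by positivity) (by positivity)
  have hδR : R * δ ≤ c / 8 := by
    calc R * δ ≤ (R + 1) * (c / (8 * (R + 1))) := by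
          refine mul_le_mul (by linarith) (min_le_right _ _) hδ.le (by linarith)
      _ = c / 8 := by field_simp
  have hsq : ∀ n : ℕ, 0 < n → 0 < Real.sqrt n := fun n hn => Real.sqrt_pos.2 (Nat.cast_pos.2 hn)
  have htpos : ∀ᶠ n in l, 0 < t n := ht.eventually_gt_atTop 0
  -- upper bounds for the log-likelihood ratio
  have hnear : ∀ᶠ n in l, ∀ u : 𝔼, ‖u‖ ≤ δ →
      M n (θh n + u) - M n (θh n) ≤ -(c / 4) * (t n * ‖u‖ ^ 2) := by
    filter_upwards [htaylor, hη.eventually_lt_const (show (0 : ℝ) < c / 8 by positivity)]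
      with n h1 h2 u hu
    have h3 := (abs_le.1 (h1 u)).2
    have h4 : R * ‖u‖ ^ 3 ≤ c / 8 * ‖u‖ ^ 2 := by
      calc R * ‖u‖ ^ 3 = R * ‖u‖ * ‖u‖ ^ 2 := by ring
        _ ≤ R * δ * ‖u‖ ^ 2 := by gcongr
        _ ≤ c / 8 * ‖u‖ ^ 2 := by gcongr
    have h5 : η n * ‖u‖ ^ 2 ≤ c / 8 * ‖u‖ ^ 2 := by gcongr
    have h6 : (t n : ℝ) * (η n * ‖u‖ ^ 2 + R * ‖u‖ ^ 3) ≤ t n * (c / 4 * ‖u‖ ^ 2) := by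
      gcongr
      linarith
    have h7 : (t n : ℝ) * (c * ‖u‖ ^ 2) ≤ t n * quadForm V u := by
      gcongr
      exact hcV u
    linarith
  have hfar : ∀ᶠ n in l, ∀ u : 𝔼, δ ≤ ‖u‖ →
      M n (θh n + u) - M n (θh n) ≤ -(c / 4 * δ ^ 2) * t n := by
    filter_upwards [hnear] with n h1 u hu
    have := ConcaveOn.sub_le_of_sphere (hMconc n) (θ := θh n) hδ
      (K := c / 4 * δ ^ 2 * t n) (by positivity) (fun v hv => ?_) hu
    · linarith
    · have := h1 v hv.le
      rw [hv] at this
      linarith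
  set F : ι → 𝔼 → ℝ := fun n => localDensity (M n) π (t n) (θh n) with hF
  set f : 𝔼 → ℝ := fun h => Real.exp (-quadForm V h / 2) * π θ₀ with hf
  have hfint : Integrable f := (integrable_exp_quadForm hV).mul_const _
  have hFint : ∀ᶠ n in l, Integrable (F n) := by
    filter_upwards [htpos, hmax] with n h1 h2
    exact integrable_localDensity (hMcont n) hπm hπ hπi h1 h2
  set B : ι → Set 𝔼 := fun n => Metric.closedBall 0 (δ * Real.sqrt (t n)) with hB
  have hBm : ∀ n, MeasurableSet (B n) := fun n => Metric.isClosed_closedBall.measurableSet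
  have hmem : ∀ n h, h ∈ B n ↔ ‖h‖ ≤ δ * Real.sqrt (t n) := fun n h => by simp [hB]
  have hsqrt_lim : Tendsto (fun n => Real.sqrt (t n)) l atTop :=
    Real.tendsto_sqrt_atTop.comp (tendsto_natCast_atTop_atTop.comp ht)
  have hunorm : ∀ n, 0 < t n → ∀ h : 𝔼, ‖(Real.sqrt (t n))⁻¹ • h‖ = ‖h‖ / Real.sqrt (t n) := by
    intro n hn h
    rw [norm_smul, Real.norm_of_nonneg (by positivity), div_eq_inv_mul]
  have hball : ∀ n, 0 < t n → ∀ h : 𝔼, h ∈ B n ↔ ‖(Real.sqrt (t n))⁻¹ • h‖ ≤ δ := by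
    intro n hn h
    rw [hmem, hunorm n hn, div_le_iff₀ (hsq _ hn)]
  -- the central part
  have hcentral : Tendsto (fun n => ∫ h : 𝔼, |(B n).indicator (F n) h - f h|) l (𝓝 0) := by
    have hlim := tendsto_integral_filter_of_dominated_convergence (μ := (volume : Measure 𝔼))
      (l := l) (F := fun n h => |(B n).indicator (F n) h - f h|) (f := fun _ => 0)
      (fun h => (π θ₀ + 1) * Real.exp (-(c / 4) * ‖h‖ ^ 2) + f h)
      (Eventually.of_forall fun n => ?_) ?_
      (((integrable_exp_neg_mul_norm_sq (by positivity)).const_mul _).add hfint) ?_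
    · simpa using hlim
    · exact (((measurable_localDensity (hMcont n) hπm (t n) (θh n)).indicator
        (hBm n)).aestronglyMeasurable.sub hfint.aestronglyMeasurable).norm
    · filter_upwards [hnear, htpos, Metric.tendsto_nhds.1 hθ (δ₁ / 2) (by positivity)]
        with n h1 h2 h3
      refine Eventually.of_forall fun h => ?_
      have hf0 : 0 ≤ f h := mul_nonneg (Real.exp_pos _).le (hπ _)
      rw [Real.norm_of_nonneg (abs_nonneg _)]
      refine (abs_sub _ _).trans ?_
      rw [abs_of_nonneg hf0]
      refine add_le_add_left ?_ _
      by_cases hh : h ∈ B n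
      · rw [Set.indicator_of_mem hh, abs_of_nonneg (localDensity_nonneg hπ _ _ _)]
        have hu := (hball n h2 h).1 hh
        have h4 := h1 _ hu
        have h5 : (t n : ℝ) * ‖(Real.sqrt (t n))⁻¹ • h‖ ^ 2 = ‖h‖ ^ 2 := by
          rw [hunorm n h2, div_pow, Real.sq_sqrt (Nat.cast_nonneg _)]
          have : (t n : ℝ) ≠ 0 := Nat.cast_ne_zero.2 h2.ne'
          field_simp
        rw [h5] at h4
        have h6 : π (θh n + (Real.sqrt (t n))⁻¹ • h) ≤ π θ₀ + 1 := by
          have hd : dist (θh n + (Real.sqrt (t n))⁻¹ • h) θ₀ < δ₁ := by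
            have e1 : dist (θh n + (Real.sqrt (t n))⁻¹ • h) (θh n) ≤ δ₁ / 2 := by
              rw [dist_eq_norm, add_sub_cancel_left]
              exact hu.trans (min_le_left _ _)
            linarith [dist_triangle (θh n + (Real.sqrt (t n))⁻¹ • h) (θh n) θ₀]
          have := hπδ hd
          rw [Real.dist_eq] at this
          linarith [(abs_lt.1 this).2]
        rw [mul_comm]
        simp only [localDensity]
        exact mul_le_mul (Real.exp_le_exp.2 h4) h6 (hπ _) (Real.exp_pos _).le
      · rw [Set.indicator_of_notMem hh, abs_zero]
        have := hπ θ₀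
        positivity
    · refine Eventually.of_forall fun h => ?_
      have hinv : Tendsto (fun n => (Real.sqrt (t n))⁻¹) l (𝓝 0) := hsqrt_lim.inv_tendsto_atTop
      have hpt : Tendsto (fun n => θh n + (Real.sqrt (t n))⁻¹ • h) l (𝓝 θ₀) := by
        simpa using hθ.add (hinv.smul_const h)
      -- At u = h/√t the Taylor error equals η‖h‖² + R‖h‖³/√t, which vanishes for each fixed h.
      have hexp : Tendsto (fun n => M n (θh n + (Real.sqrt (t n))⁻¹ • h) - M n (θh n)) l
          (𝓝 (-quadForm V h / 2)) := by
        rw [tendsto_iff_norm_sub_tendsto_zero]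
        have hz : Tendsto (fun n => η n * ‖h‖ ^ 2 + R * ‖h‖ ^ 3 * (Real.sqrt (t n))⁻¹) l (𝓝 0) := by
          simpa using (hη.mul_const (‖h‖ ^ 2)).add (hinv.const_mul (R * ‖h‖ ^ 3))
        refine squeeze_zero' (Eventually.of_forall fun n => norm_nonneg _) ?_ hz
        filter_upwards [htaylor, htpos] with n h1 h2
        have h3 := h1 ((Real.sqrt (t n))⁻¹ • h)
        have hs := hsq _ h2
        have hts : (t n : ℝ) = Real.sqrt (t n) ^ 2 := (Real.sq_sqrt (Nat.cast_nonneg _)).symm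
        have e1 : (t n : ℝ) * quadForm V ((Real.sqrt (t n))⁻¹ • h) = quadForm V h := by
          rw [quadForm_smul]
          nth_rewrite 1 [hts]
          field_simp
        have e2 : (t n : ℝ) * (η n * ‖(Real.sqrt (t n))⁻¹ • h‖ ^ 2 +
            R * ‖(Real.sqrt (t n))⁻¹ • h‖ ^ 3) =
            η n * ‖h‖ ^ 2 + R * ‖h‖ ^ 3 * (Real.sqrt (t n))⁻¹ := by
          rw [hunorm n h2]
          nth_rewrite 1 [hts]
          field_simp
        rw [e1, e2] at h3
        rw [Real.norm_eq_abs]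
        convert h3 using 2
        ring
      have hFlim : Tendsto (fun n => F n h) l (𝓝 (f h)) :=
        ((Real.continuous_exp.tendsto _).comp hexp).mul (hπc.tendsto.comp hpt)
      have hin : ∀ᶠ n in l, h ∈ B n := by
        filter_upwards [hsqrt_lim.eventually_ge_atTop (‖h‖ / δ)] with n hn
        rw [hmem]
        rw [div_le_iff₀ hδ] at hn
        linarith
      have : Tendsto (fun n => (B n).indicator (F n) h) l (𝓝 (f h)) :=
        hFlim.congr' (hin.mono fun n hn => (Set.indicator_of_mem hn _).symm)
      simpa using (this.sub_const (f h)).abs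
  -- the tails
  have htail : Tendsto (fun n => ∫ h : 𝔼, |F n h - (B n).indicator (F n) h|) l (𝓝 0) := by
    -- The far bound on the likelihood ratio is uniform, so the remaining integral is that of the
    -- rescaled prior, √t^p ∫ π; no decay of π beyond integrability is needed.
    have hz : Tendsto (fun n => Real.sqrt (t n) ^ p * Real.exp (-(c / 4 * δ ^ 2) * t n) *
        ∫ θ, π θ) l (𝓝 0) := by
      simpa using ((tendsto_sqrt_pow_mul_exp_neg (show 0 < c / 4 * δ ^ 2 by positivity) p).comp
        ht).mul_const (∫ θ, π θ)
    refine squeeze_zero' (Eventually.of_forall fun n => integral_nonneg fun h => abs_nonneg _) ?_ hz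
    filter_upwards [hfar, htpos, hFint] with n h1 h2 h3
    have hs := hsq _ h2
    calc ∫ h : 𝔼, |F n h - (B n).indicator (F n) h|
        ≤ ∫ h : 𝔼, Real.exp (-(c / 4 * δ ^ 2) * t n) * π (θh n + (Real.sqrt (t n))⁻¹ • h) := by
          refine integral_mono (h3.sub (h3.indicator (hBm n))).abs
            ((integrable_comp_add_smul hπi _ hs.ne').const_mul _) fun h => ?_
          simp only
          by_cases hh : h ∈ B n
          · rw [Set.indicator_of_mem hh, sub_self, abs_zero]
            exact mul_nonneg (Real.exp_pos _).le (hπ _)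
          · rw [Set.indicator_of_notMem hh, sub_zero, abs_of_nonneg (localDensity_nonneg hπ _ _ _)]
            refine mul_le_mul_of_nonneg_right (Real.exp_le_exp.2 (h1 _ ?_)) (hπ _)
            rw [hball n h2] at hh
            exact (not_le.1 hh).le
      _ = _ := by
          rw [integral_const_mul, integral_comp_add_smul π _ hs.le]
          ring
  have hsum := htail.add hcentral
  rw [add_zero] at hsum
  refine squeeze_zero' (Eventually.of_forall fun n => integral_nonneg fun h => abs_nonneg _) ?_ hsum
  filter_upwards [hFint] with n h3
  have i1 : Integrable fun h => |F n h - (B n).indicator (F n) h| :=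
    (h3.sub (h3.indicator (hBm n))).abs
  have i2 : Integrable fun h => |(B n).indicator (F n) h - f h| :=
    ((h3.indicator (hBm n)).sub hfint).abs
  rw [← integral_add i1 i2]
  refine integral_mono (h3.sub hfint).abs (i1.add i2) fun h => ?_
  exact abs_sub_le _ _ _

end Laplace

/-! ### Consistency of the M-estimator -/

section Consistency

variable {m p : ℕ} {A : Matrix (Fin m) (Fin m) ℝ}

/-- The logarithm of the surrogate likelihood of agent `j` at time `t`. -/
noncomputable abbrev agentLogLik (A : Matrix (Fin m) (Fin m) ℝ)
    (x : Fin m → ℕ → EuclideanSpace ℝ (Fin p)) (y : Fin m → ℕ → Fin 2) (t : ℕ) (j : Fin m)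
    (θ : EuclideanSpace ℝ (Fin p)) : ℝ :=
  logLik (obsIndex m t) (agentWeight A t j) (fun a => x a.2 a.1) (fun a => resp (y a.2 a.1)) θ

lemma agentLogLik_eq_inner_sub (x : Fin m → ℕ → EuclideanSpace ℝ (Fin p)) (y : Fin m → ℕ → Fin 2)
    (t : ℕ) (j : Fin m) (θ : EuclideanSpace ℝ (Fin p)) :
    agentLogLik A x y t j θ =
      inner ℝ θ (sufficientStat A x y t j) - logPartition A x t j θ := by
  rw [agentLogLik, logLik, sum_obsIndex, sufficientStat, logPartition]
  simp only [inner_sum, real_inner_smul_right, ← Finset.sum_sub_distrib]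
  refine Finset.sum_congr rfl fun k _ => Finset.sum_congr rfl fun i _ => ?_
  simp only [agentWeight, resp]
  ring

lemma isMEstimate_iff {x : Fin m → ℕ → EuclideanSpace ℝ (Fin p)} {y : Fin m → ℕ → Fin 2}
    {t : ℕ} {j : Fin m} {θ : EuclideanSpace ℝ (Fin p)} :
    IsMEstimate A x y t j θ ↔ ∀ θ', agentLogLik A x y t j θ' ≤ agentLogLik A x y t j θ := by
  simp only [IsMEstimate, agentLogLik_eq_inner_sub]

variable {G : SimpleGraph (Fin m)} {Ω : Type*} [MeasurableSpace Ω] {P : Measure Ω}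
  [IsProbabilityMeasure P] {X : Fin m → ℕ → Ω → EuclideanSpace ℝ (Fin p)}
  {Y : Fin m → ℕ → Ω → Fin 2} {μ : Measure (EuclideanSpace ℝ (Fin p))} [IsProbabilityMeasure μ]
  {θ₀ : EuclideanSpace ℝ (Fin p)}

omit [IsProbabilityMeasure μ] in
lemma tendsto_average_pair (hA : IsCommunicationMatrix G A)
    (hX : ∀ j k, Measurable (X j k)) (hY : ∀ j k, Measurable (Y j k))
    (hindep : iIndepFun (fun (jk : Fin m × ℕ) (ω : Ω) => (X jk.1 jk.2 ω, Y jk.1 jk.2 ω)) P)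
    (hlaw : ∀ j k, P.map (fun ω => (X j k ω, Y j k ω)) = pairLaw μ θ₀)
    {f : EuclideanSpace ℝ (Fin p) × Fin 2 → ℝ} (hf : Measurable f)
    (hfi : Integrable f (pairLaw μ θ₀)) (j : Fin m) :
    Tendsto (fun z : ℕ × Ω => (z.1 : ℝ)⁻¹ * ∑ a ∈ obsIndex m z.1,
      agentWeight A z.1 j a * f (X a.2 a.1 z.2, Y a.2 a.1 z.2))
      (inProb P) (𝓝 (∫ z, f z ∂(pairLaw μ θ₀))) :=
  tendsto_weighted_average (Z := fun i k ω => (X i k ω, Y i k ω)) hA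
    (fun i k => (hX i k).prodMk (hY i k)) hlaw hindep hf hfi j

lemma tendsto_average_covariate (hA : IsCommunicationMatrix G A)
    (hX : ∀ j k, Measurable (X j k)) (hY : ∀ j k, Measurable (Y j k))
    (hindep : iIndepFun (fun (jk : Fin m × ℕ) (ω : Ω) => (X jk.1 jk.2 ω, Y jk.1 jk.2 ω)) P)
    (hlaw : ∀ j k, P.map (fun ω => (X j k ω, Y j k ω)) = pairLaw μ θ₀)
    {f : EuclideanSpace ℝ (Fin p) → ℝ} (hf : Measurable f) (hfi : Integrable f μ) (j : Fin m) :
    Tendsto (fun z : ℕ × Ω => (z.1 : ℝ)⁻¹ * ∑ a ∈ obsIndex m z.1,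
      agentWeight A z.1 j a * f (X a.2 a.1 z.2)) (inProb P) (𝓝 (∫ x, f x ∂μ)) := by
  rw [← integral_comp_fst_pairLaw (μ := μ) θ₀ hf]
  exact tendsto_average_pair hA hX hY hindep hlaw (hf.comp measurable_fst)
    (integrable_comp_fst_pairLaw θ₀ hfi) j

lemma tendsto_uniform_average_covariate [NeZero m]
    (hX : ∀ j k, Measurable (X j k)) (hY : ∀ j k, Measurable (Y j k))
    (hindep : iIndepFun (fun (jk : Fin m × ℕ) (ω : Ω) => (X jk.1 jk.2 ω, Y jk.1 jk.2 ω)) P)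
    (hlaw : ∀ j k, P.map (fun ω => (X j k ω, Y j k ω)) = pairLaw μ θ₀)
    {f : EuclideanSpace ℝ (Fin p) → ℝ} (hf : Measurable f) (hfi : Integrable f μ) :
    Tendsto (fun z : ℕ × Ω => (z.1 : ℝ)⁻¹ * ∑ a ∈ obsIndex m z.1,
      (1 / m : ℝ) * f (X a.2 a.1 z.2)) (inProb P) (𝓝 (∫ x, f x ∂μ)) := by
  rw [← integral_comp_fst_pairLaw (μ := μ) θ₀ hf]
  exact tendsto_uniform_average (Z := fun i k ω => (X i k ω, Y i k ω))
    (f := fun z : EuclideanSpace ℝ (Fin p) × Fin 2 => f z.1)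
    (fun i k => (hX i k).prodMk (hY i k)) hlaw hindep (hf.comp measurable_fst)
    (integrable_comp_fst_pairLaw θ₀ hfi)

/-- With high probability the log-likelihood at the truth exceeds its values on a sphere. -/
lemma eventually_agentLogLik_lt_on_sphere (hA : IsCommunicationMatrix G A)
    (hX : ∀ j k, Measurable (X j k)) (hY : ∀ j k, Measurable (Y j k))
    (hindep : iIndepFun (fun (jk : Fin m × ℕ) (ω : Ω) => (X jk.1 jk.2 ω, Y jk.1 jk.2 ω)) P)
    (hlaw : ∀ j k, P.map (fun ω => (X j k ω, Y j k ω)) = pairLaw μ θ₀)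
    (hne : ∀ θ, θ ≠ θ₀ → pairLaw μ θ ≠ pairLaw μ θ₀)
    (hlog : ∀ θ, Integrable (fun z : EuclideanSpace ℝ (Fin p) × Fin 2 =>
      Real.log (condProb θ z.1 z.2)) (pairLaw μ θ₀))
    (j : Fin m) {ε : ℝ} (hε : 0 < ε) :
    ∀ᶠ z : ℕ × Ω in inProb P, ∀ θ ∈ Metric.sphere θ₀ ε,
      agentLogLik A (fun i k => X i k z.2) (fun i k => Y i k z.2) z.1 j θ <
        agentLogLik A (fun i k => X i k z.2) (fun i k => Y i k z.2) z.1 j θ₀ := by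
  set K : EuclideanSpace ℝ (Fin p) → ℝ :=
    fun θ => ∫ z, Real.log (condProb θ z.1 z.2) ∂(pairLaw μ θ₀) with hK
  set ℓ : ℕ × Ω → EuclideanSpace ℝ (Fin p) → ℝ := fun z θ =>
    agentLogLik A (fun i k => X i k z.2) (fun i k => Y i k z.2) z.1 j θ with hℓ
  have hlim : ∀ θ, Tendsto (fun z : ℕ × Ω => (z.1 : ℝ)⁻¹ * ℓ z θ) (inProb P) (𝓝 (K θ)) := by
    intro θ
    refine (tendsto_average_pair hA hX hY hindep hlaw (measurable_condProb θ).log (hlog θ) j).congr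
      fun z => ?_
    simp only [log_condProb]
    rfl
  set C : ℝ := ∫ z, ‖z.1‖ ∂(pairLaw μ θ₀) + 1 with hC
  have hCpos : 0 < C := by
    have : 0 ≤ ∫ z, ‖z.1‖ ∂(pairLaw μ θ₀) := integral_nonneg fun z => norm_nonneg _
    linarith
  have hnorm : ∀ᶠ z : ℕ × Ω in inProb P, (z.1 : ℝ)⁻¹ * ∑ a ∈ obsIndex m z.1,
      agentWeight A z.1 j a * ‖X a.2 a.1 z.2‖ < C :=
    (tendsto_average_pair hA hX hY hindep hlaw (f := fun z => ‖z.1‖) measurable_fst.norm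
      (integrable_norm_fst_pairLaw hlog) j).eventually_lt_const (by rw [hC]; linarith)
  -- The property passes to subsets and finite unions, so by compactness it suffices to prove it on
  -- a ball around each point of the sphere.
  refine (isCompact_sphere θ₀ ε).induction_on
    (p := fun s => ∀ᶠ z : ℕ × Ω in inProb P, ∀ θ ∈ s, ℓ z θ < ℓ z θ₀) ?_ ?_ ?_ ?_
  · simp
  · intro s s' hss h
    filter_upwards [h] with z hz θ hθ using hz θ (hss hθ)
  · intro s s' h h'
    filter_upwards [h, h'] with z hz hz' θ hθ
    exact hθ.elim (hz θ) (hz' θ)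
  · intro θ hθ
    have hθne : θ ≠ θ₀ := by
      rintro rfl
      rw [mem_sphere_iff_norm, sub_self, norm_zero] at hθ
      exact hε.ne hθ
    have hgap : K θ < K θ₀ := integral_log_condProb_lt hlog (hne θ hθne)
    set g := K θ₀ - K θ with hg
    have hgpos : 0 < g := sub_pos.2 hgap
    -- Then 2rC = g/4: moving within the ball costs g/4 and each of the two limits another g/4,
    -- which leaves part of the gap g.
    set r : ℝ := g / (8 * C) with hr
    have hrpos : 0 < r := by positivity
    refine ⟨Metric.ball θ r, mem_nhdsWithin_of_mem_nhds (Metric.ball_mem_nhds θ hrpos), ?_⟩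
    filter_upwards [hnorm, (hlim θ).eventually_lt_const (show K θ < K θ + g / 4 by linarith),
      (hlim θ₀).eventually_const_lt (show K θ₀ - g / 4 < K θ₀ by linarith),
      tendsto_fst_inProb.eventually_gt_atTop 0] with z h1 h2 h3 h4 θ' hθ'
    have ht : (0 : ℝ) < (z.1 : ℝ)⁻¹ := inv_pos.2 (Nat.cast_pos.2 h4)
    have hlip := abs_logLik_sub_le (S := obsIndex m z.1) (w := agentWeight A z.1 j)
      (x := fun a => X a.2 a.1 z.2) (y := fun a => resp (Y a.2 a.1 z.2))
      (fun a _ => agentWeight_nonneg hA z.1 j a) (fun a _ => abs_resp_le _) θ θ'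
    have h5 : ‖θ' - θ‖ < r := by simpa [dist_eq_norm] using hθ'
    have h6 : (z.1 : ℝ)⁻¹ * (ℓ z θ' - ℓ z θ) ≤ 2 * r * C := by
      calc (z.1 : ℝ)⁻¹ * (ℓ z θ' - ℓ z θ) ≤ (z.1 : ℝ)⁻¹ * (2 * ‖θ' - θ‖ *
            ∑ a ∈ obsIndex m z.1, agentWeight A z.1 j a * ‖X a.2 a.1 z.2‖) :=
            mul_le_mul_of_nonneg_left ((le_abs_self _).trans hlip) ht.le
        _ = 2 * ‖θ' - θ‖ * ((z.1 : ℝ)⁻¹ *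
            ∑ a ∈ obsIndex m z.1, agentWeight A z.1 j a * ‖X a.2 a.1 z.2‖) := by ring
        _ ≤ 2 * r * C := by
            refine mul_le_mul (by linarith) h1.le (mul_nonneg ht.le (Finset.sum_nonneg fun a _ =>
              mul_nonneg (agentWeight_nonneg hA z.1 j a) (norm_nonneg _))) (by positivity)
    have h7 : 2 * r * C = g / 4 := by rw [hr]; field_simp; norm_num
    have h8 : (z.1 : ℝ)⁻¹ * ℓ z θ' < (z.1 : ℝ)⁻¹ * ℓ z θ₀ := by
      rw [mul_sub] at h6
      linarith
    exact lt_of_mul_lt_mul_left h8 ht.le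

omit [IsProbabilityMeasure P] in
lemma eventually_existsUnique_isMEstimate (hA : IsCommunicationMatrix G A) (j : Fin m) {ε : ℝ}
    (hε : 0 < ε)
    (h : ∀ᶠ z : ℕ × Ω in inProb P, ∀ θ ∈ Metric.sphere θ₀ ε,
      agentLogLik A (fun i k => X i k z.2) (fun i k => Y i k z.2) z.1 j θ <
        agentLogLik A (fun i k => X i k z.2) (fun i k => Y i k z.2) z.1 j θ₀) :
    ∀ᶠ z : ℕ × Ω in inProb P,
      (∃! θ, IsMEstimate A (fun i k => X i k z.2) (fun i k => Y i k z.2) z.1 j θ) ∧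
      ∀ θ, IsMEstimate A (fun i k => X i k z.2) (fun i k => Y i k z.2) z.1 j θ →
        dist θ θ₀ < ε := by
  filter_upwards [h] with z hz
  have hw : ∀ a ∈ obsIndex m z.1, 0 ≤ agentWeight A z.1 j a :=
    fun a _ => agentWeight_nonneg hA z.1 j a
  simp only [isMEstimate_iff]
  refine ⟨existsUnique_maximizer hw hε hz, fun θ hθ => ?_⟩
  by_contra hcon
  push Not at hcon
  exact absurd (logLik_lt_of_sphere hw hε hz hcon) (not_lt.2 (hθ θ₀))

end Consistency

/-! ### The geometric mean of the priors -/

section Prior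

variable {m p : ℕ} {π : Fin m → EuclideanSpace ℝ (Fin p) → ℝ}

/-- The geometric mean of the prior densities. -/
noncomputable def geomMean (π : Fin m → EuclideanSpace ℝ (Fin p) → ℝ)
    (θ : EuclideanSpace ℝ (Fin p)) : ℝ := ∏ j, π j θ ^ (1 / m : ℝ)

lemma measurable_geomMean (hπ : ∀ j, Measurable (π j)) : Measurable (geomMean π) :=
  Finset.measurable_fun_prod _ fun j _ => (hπ j).pow_const _

lemma geomMean_nonneg (hπ : ∀ j θ, 0 ≤ π j θ) (θ : EuclideanSpace ℝ (Fin p)) :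
    0 ≤ geomMean π θ := Finset.prod_nonneg fun j _ => Real.rpow_nonneg (hπ j θ) _

/-- The weighted AM-GM inequality bounds the geometric mean by the average of the prior densities.
-/
lemma integrable_geomMean [NeZero m] (hπm : ∀ j, Measurable (π j)) (hπ : ∀ j θ, 0 ≤ π j θ)
    (hπ_one : ∀ j, ∫⁻ θ, ENNReal.ofReal (π j θ) = 1) : Integrable (geomMean π) := by
  have hint : ∀ j, Integrable (π j) := fun j => by
    refine ⟨(hπm j).aestronglyMeasurable, ?_⟩
    rw [hasFiniteIntegral_iff_ofReal (Eventually.of_forall (hπ j)), hπ_one]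
    exact ENNReal.one_lt_top
  refine (integrable_finsetSum Finset.univ fun j _ => (hint j).const_mul (1 / m : ℝ)).mono'
    (measurable_geomMean hπm).aestronglyMeasurable (Eventually.of_forall fun θ => ?_)
  rw [Real.norm_of_nonneg (geomMean_nonneg hπ θ)]
  refine Real.geom_mean_le_arith_mean_weighted Finset.univ (fun _ => (1 / m : ℝ)) (fun j => π j θ)
    (fun _ _ => by positivity) ?_ fun j _ => hπ j θ
  have hm : (m : ℝ) ≠ 0 := Nat.cast_ne_zero.2 (NeZero.ne m)
  simp [hm]

lemma continuousAt_geomMean {θ₀ : EuclideanSpace ℝ (Fin p)} (h : ∀ j, ContinuousAt (π j) θ₀) :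
    ContinuousAt (geomMean π) θ₀ :=
  tendsto_finsetProd _ fun j _ => (h j).rpow_const (Or.inr (by positivity))

lemma geomMean_pos {θ₀ : EuclideanSpace ℝ (Fin p)} (h : ∀ j, 0 < π j θ₀) : 0 < geomMean π θ₀ :=
  Finset.prod_pos fun j _ => Real.rpow_pos_of_pos (h j) _

lemma lintegral_ofReal_ne_zero_of_continuousAt {f : EuclideanSpace ℝ (Fin p) → ℝ}
    (hf : Measurable f) {θ₀ : EuclideanSpace ℝ (Fin p)} (hc : ContinuousAt f θ₀)
    (hpos : 0 < f θ₀) : ∫⁻ θ, ENNReal.ofReal (f θ) ≠ 0 := by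
  intro h
  rw [lintegral_eq_zero_iff hf.ennreal_ofReal] at h
  have h1 : ∀ᶠ θ in 𝓝 θ₀, 0 < f θ := hc.eventually (eventually_gt_nhds hpos)
  have h2 := Measure.measure_pos_of_mem_nhds volume h1
  refine h2.ne' (measure_mono_null (fun θ hθ => ?_) (ae_iff.1 h))
  simpa using hθ

end Prior

/-! ### Density of the rescaled posterior -/

section Posterior

variable {p : ℕ}

local notation "𝔼" => EuclideanSpace ℝ (Fin p)

/-- The factor K is a Jacobian. It is left unspecified because the total mass of the posterior later
fixes all constants at once. -/
lemma map_withDensity_affine {k : 𝔼 → ℝ≥0∞} (hk : Measurable k) (c : 𝔼) {s : ℝ} (hs : s ≠ 0) :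
    ∃ K : ℝ≥0∞, ((volume : Measure 𝔼).withDensity k).map (fun θ => s • (θ - c)) =
      K • (volume : Measure 𝔼).withDensity (fun h => k (c + s⁻¹ • h)) := by
  refine ⟨ENNReal.ofReal |(s ^ Module.finrank ℝ 𝔼)⁻¹|, ?_⟩
  have he : Measurable fun θ : 𝔼 => s • (θ - c) := by fun_prop
  have hk' : Measurable fun h : 𝔼 => k (c + s⁻¹ • h) := hk.comp (by fun_prop)
  ext B hB
  set Φ : 𝔼 → ℝ≥0∞ := B.indicator fun h => k (c + s⁻¹ • h) with hΦ
  have hΦm : Measurable Φ := hk'.indicator hB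
  rw [Measure.map_apply he hB, withDensity_apply _ (he hB), Measure.smul_apply,
    withDensity_apply _ hB, ← lintegral_indicator (he hB), ← lintegral_indicator hB]
  have h1 : ∀ θ, ((fun θ : 𝔼 => s • (θ - c)) ⁻¹' B).indicator k θ = Φ (s • (θ - c)) := by
    intro θ
    by_cases hθ : s • (θ - c) ∈ B
    · rw [Set.indicator_of_mem (show θ ∈ (fun θ : 𝔼 => s • (θ - c)) ⁻¹' B from hθ), hΦ,
        Set.indicator_of_mem hθ, smul_smul, inv_mul_cancel₀ hs, one_smul, add_sub_cancel]
    · rw [Set.indicator_of_notMem (show θ ∉ (fun θ : 𝔼 => s • (θ - c)) ⁻¹' B from hθ), hΦ,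
        Set.indicator_of_notMem hθ]
  simp only [h1]
  rw [lintegral_sub_right_eq_self (fun θ => Φ (s • θ)) c,
    ← lintegral_map hΦm (measurable_const_smul s), Measure.map_addHaar_smul volume hs,
    lintegral_smul_measure]

variable {m : ℕ} {A : Matrix (Fin m) (Fin m) ℝ} {G : SimpleGraph (Fin m)}
  {π : Fin m → EuclideanSpace ℝ (Fin p) → ℝ}
  {x : Fin m → ℕ → EuclideanSpace ℝ (Fin p)} {y : Fin m → ℕ → Fin 2}

/-- The posterior uses the exponents ij and the estimator the weights ji; symmetry of the powers of
A identifies them. -/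
lemma surrogateLikelihood_eq_exp (hA : A.IsSymm) (t : ℕ) (j : Fin m) (θ : 𝔼) :
    surrogateLikelihood A x y t j θ = Real.exp (agentLogLik A x y t j θ) := by
  rw [agentLogLik, logLik, sum_obsIndex, surrogateLikelihood]
  simp only [Real.exp_sum]
  refine Finset.prod_congr rfl fun k _ => Finset.prod_congr rfl fun i _ => ?_
  rw [Real.rpow_def_of_pos (condProb_pos _ _ _), log_condProb, agentWeight, mul_comm]
  congr 2
  exact (hA.pow _).apply j i

lemma agentLogLik_nonpos (hA : IsCommunicationMatrix G A) (t : ℕ) (j : Fin m) (θ : 𝔼) :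
    agentLogLik A x y t j θ ≤ 0 := by
  refine Finset.sum_nonpos fun a _ => ?_
  have h := Real.log_nonpos (condProb_pos θ (x a.2 a.1) (y a.2 a.1)).le (condProb_le_one _ _ _)
  rw [log_condProb] at h
  exact mul_nonpos_of_nonneg_of_nonpos (agentWeight_nonneg hA t j a) h

/-- The posterior is a probability measure with density proportional to the prior density times
the surrogate likelihood. -/
lemma exists_posterior_eq (hA : IsCommunicationMatrix G A) (hπm : ∀ j, Measurable (π j))
    (hπ : ∀ j θ, 0 ≤ π j θ) (hπi : Integrable (geomMean π))
    (hZ : ∫⁻ θ, ENNReal.ofReal (geomMean π θ) ≠ 0) (t : ℕ) (j : Fin m) :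
    posterior A x y π t j Set.univ = 1 ∧ ∃ K : ℝ≥0∞, posterior A x y π t j =
      K • (volume : Measure 𝔼).withDensity fun θ =>
        ENNReal.ofReal (Real.exp (agentLogLik A x y t j θ) * geomMean π θ) := by
  have hLm : Measurable fun θ : 𝔼 => ENNReal.ofReal (Real.exp (agentLogLik A x y t j θ)) :=
    (continuous_logLik.rexp).measurable.ennreal_ofReal
  have hgm : Measurable fun θ : 𝔼 => ENNReal.ofReal (geomMean π θ) :=
    (measurable_geomMean hπm).ennreal_ofReal
  have hprior : priorMeasure π = (∫⁻ θ, ENNReal.ofReal (geomMean π θ))⁻¹ •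
      ((volume : Measure 𝔼).withDensity fun θ => ENNReal.ofReal (geomMean π θ)) := rfl
  set Z := ∫⁻ θ, ENNReal.ofReal (geomMean π θ) with hZd
  have hZtop : Z ≠ ∞ := by
    have := hπi.2
    rw [hasFiniteIntegral_iff_ofReal (Eventually.of_forall (geomMean_nonneg hπ))] at this
    exact this.ne
  set D : Measure 𝔼 := (volume : Measure 𝔼).withDensity fun θ =>
    ENNReal.ofReal (Real.exp (agentLogLik A x y t j θ) * geomMean π θ) with hD
  have hpd : ((priorMeasure π).withDensity fun θ =>
      ENNReal.ofReal (surrogateLikelihood A x y t j θ)) = Z⁻¹ • D := by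
    simp only [surrogateLikelihood_eq_exp hA.symm]
    rw [hprior, withDensity_smul_measure, ← withDensity_mul _ hgm hLm, hD]
    congr 2
    ext θ
    rw [Pi.mul_apply, ENNReal.ofReal_mul (Real.exp_pos _).le, mul_comm]
  have hW : ∫⁻ θ, ENNReal.ofReal (surrogateLikelihood A x y t j θ) ∂(priorMeasure π) =
      (Z⁻¹ • D) Set.univ := by
    rw [← hpd, withDensity_apply _ MeasurableSet.univ, Measure.restrict_univ]
  have hpost : posterior A x y π t j = ((Z⁻¹ • D) Set.univ)⁻¹ • (Z⁻¹ • D) := by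
    rw [posterior, hW, hpd]
  have hDuniv : D Set.univ =
      ∫⁻ θ, ENNReal.ofReal (Real.exp (agentLogLik A x y t j θ) * geomMean π θ) := by
    rw [hD, withDensity_apply _ MeasurableSet.univ, Measure.restrict_univ]
  have hDtop : D Set.univ ≠ ∞ := by
    rw [hDuniv]
    refine ne_top_of_le_ne_top hZtop (lintegral_mono fun θ => ENNReal.ofReal_le_ofReal ?_)
    exact mul_le_of_le_one_left (geomMean_nonneg hπ θ)
      (Real.exp_le_one_iff.2 (agentLogLik_nonpos hA t j θ))
  have hD0 : D Set.univ ≠ 0 := by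
    rw [hDuniv]
    intro h
    apply hZ
    have hm : Measurable fun θ : 𝔼 =>
        ENNReal.ofReal (Real.exp (agentLogLik A x y t j θ) * geomMean π θ) :=
      ((continuous_logLik.rexp).measurable.mul (measurable_geomMean hπm)).ennreal_ofReal
    rw [lintegral_eq_zero_iff hm] at h
    rw [lintegral_eq_zero_iff hgm]
    filter_upwards [h] with θ hθ
    rw [Pi.zero_apply, ENNReal.ofReal_eq_zero] at hθ ⊢
    exact nonpos_of_mul_nonpos_right hθ (Real.exp_pos _)
  refine ⟨?_, ((Z⁻¹ • D) Set.univ)⁻¹ * Z⁻¹, by rw [hpost, smul_smul]⟩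
  rw [hpost, Measure.smul_apply, smul_eq_mul]
  refine ENNReal.inv_mul_cancel ?_ ?_ <;> rw [Measure.smul_apply, smul_eq_mul]
  · exact mul_ne_zero (ENNReal.inv_ne_zero.2 hZtop) hD0
  · exact ENNReal.mul_ne_top (ENNReal.inv_ne_top.2 hZ) hDtop

/-- The density of the rescaled posterior is the normalized local density. -/
lemma pdf_posterior_ae_eq (hA : IsCommunicationMatrix G A) (hπm : ∀ j, Measurable (π j))
    (hπ : ∀ j θ, 0 ≤ π j θ) (hπi : Integrable (geomMean π))
    (hZ : ∫⁻ θ, ENNReal.ofReal (geomMean π θ) ≠ 0) {t : ℕ} (ht : 0 < t) (j : Fin m) (θh : 𝔼) :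
    ∀ᵐ h : 𝔼, (pdf (fun θ => Real.sqrt t • (θ - θh)) (posterior A x y π t j) volume h).toReal =
      (∫ h, localDensity (agentLogLik A x y t j) (geomMean π) t θh h)⁻¹ *
        localDensity (agentLogLik A x y t j) (geomMean π) t θh h := by
  set F := localDensity (agentLogLik A x y t j) (geomMean π) t θh with hF
  have hFm : Measurable F := measurable_localDensity continuous_logLik (measurable_geomMean hπm) t θh
  have hF0 : ∀ h, 0 ≤ F h := localDensity_nonneg (geomMean_nonneg hπ) t θh
  have hs : Real.sqrt t ≠ 0 := (Real.sqrt_pos.2 (Nat.cast_pos.2 ht)).ne'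
  obtain ⟨hone, K, hK⟩ := exists_posterior_eq (x := x) (y := y) hA hπm hπ hπi hZ t j
  have hem : Measurable fun θ : 𝔼 => Real.sqrt t • (θ - θh) := by fun_prop
  have hm : Measurable fun θ : 𝔼 =>
      ENNReal.ofReal (Real.exp (agentLogLik A x y t j θ) * geomMean π θ) :=
    ((continuous_logLik.rexp).measurable.mul (measurable_geomMean hπm)).ennreal_ofReal
  obtain ⟨K', hK'⟩ := map_withDensity_affine hm θh hs
  have hdens : (fun h : 𝔼 => ENNReal.ofReal (Real.exp (agentLogLik A x y t j
      (θh + (Real.sqrt t)⁻¹ • h)) * geomMean π (θh + (Real.sqrt t)⁻¹ • h))) =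
      ENNReal.ofReal (Real.exp (agentLogLik A x y t j θh)) • fun h => ENNReal.ofReal (F h) := by
    ext h
    rw [Pi.smul_apply, smul_eq_mul, ← ENNReal.ofReal_mul (Real.exp_pos _).le, hF, localDensity,
      ← mul_assoc, ← Real.exp_add]
    congr 3
    ring
  obtain ⟨C, hC⟩ : ∃ C : ℝ≥0∞, (posterior A x y π t j).map (fun θ => Real.sqrt t • (θ - θh)) =
      (volume : Measure 𝔼).withDensity (C • fun h => ENNReal.ofReal (F h)) := by
    refine ⟨K * (K' * ENNReal.ofReal (Real.exp (agentLogLik A x y t j θh))), ?_⟩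
    rw [hK, Measure.map_smul, hK', hdens, withDensity_smul _ hFm.ennreal_ofReal,
      withDensity_smul _ hFm.ennreal_ofReal, smul_smul, smul_smul, mul_assoc]
  -- C gathers the Jacobian, the normalizers and the likelihood at θh; the posterior being a
  -- probability measure determines it.
  have hC1 : C * ∫⁻ h, ENNReal.ofReal (F h) = 1 := by
    have h1 : (posterior A x y π t j).map (fun θ => Real.sqrt t • (θ - θh)) Set.univ = 1 := by
      rw [Measure.map_apply hem MeasurableSet.univ, Set.preimage_univ, hone]
    rw [hC, withDensity_apply _ MeasurableSet.univ, Measure.restrict_univ] at h1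
    simp only [Pi.smul_apply, smul_eq_mul] at h1
    rwa [lintegral_const_mul _ hFm.ennreal_ofReal] at h1
  have hCreal : C.toReal = (∫ h, F h)⁻¹ := by
    rw [integral_eq_lintegral_of_nonneg_ae (Eventually.of_forall hF0) hFm.aestronglyMeasurable]
    have := congrArg ENNReal.toReal hC1
    rw [ENNReal.toReal_mul, ENNReal.toReal_one] at this
    exact eq_inv_of_mul_eq_one_left this
  have hrn := Measure.rnDeriv_withDensity (volume : Measure 𝔼)
    (f := C • fun h => ENNReal.ofReal (F h)) (hFm.ennreal_ofReal.const_smul C)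
  filter_upwards [hrn] with h hh
  rw [pdf_def, hC, hh, Pi.smul_apply, smul_eq_mul, ENNReal.toReal_mul,
    ENNReal.toReal_ofReal (hF0 h), hCreal]

end Posterior

/-! ### Fisher information and third moments -/

section Fisher

variable {m p : ℕ}

lemma avgFisher_apply (x : Fin m → ℕ → EuclideanSpace ℝ (Fin p)) (t : ℕ)
    (θ : EuclideanSpace ℝ (Fin p)) (a b : Fin p) :
    avgFisher x t θ a b = (t : ℝ)⁻¹ * ∑ o ∈ obsIndex m t, (1 / m : ℝ) *
      (bernVar (inner ℝ θ (x o.2 o.1)) * (x o.2 o.1 a * x o.2 o.1 b)) := by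
  rw [sum_obsIndex, Finset.sum_comm, avgFisher, Matrix.smul_apply, Matrix.sum_apply, smul_eq_mul]
  simp only [← Finset.mul_sum]
  rw [← mul_assoc]
  congr 1
  · rw [one_div, one_div, mul_inv, mul_comm]
  · refine Finset.sum_congr rfl fun i _ => ?_
    rw [Finset.sum_range, Matrix.mul_apply]
    refine Finset.sum_congr rfl fun k _ => ?_
    rw [weightMatrix, Matrix.mul_diagonal, bernVar_eq]
    simp only [designMatrix, Matrix.transpose_apply, Matrix.of_apply]
    ring

lemma isHermitian_avgFisher (x : Fin m → ℕ → EuclideanSpace ℝ (Fin p)) (t : ℕ)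
    (θ : EuclideanSpace ℝ (Fin p)) : (avgFisher x t θ).IsHermitian := by
  ext a b
  rw [Matrix.conjTranspose_apply, star_trivial, avgFisher_apply, avgFisher_apply]
  congr 1
  refine Finset.sum_congr rfl fun o _ => ?_
  ring

/-- The Fisher information matrix of one observation. -/
noncomputable def fisherInfo (μ : Measure (EuclideanSpace ℝ (Fin p)))
    (θ : EuclideanSpace ℝ (Fin p)) : Matrix (Fin p) (Fin p) ℝ :=
  Matrix.of fun a b => ∫ x, bernVar (inner ℝ θ x) * (x a * x b) ∂μ

variable {μ : Measure (EuclideanSpace ℝ (Fin p))} {θ : EuclideanSpace ℝ (Fin p)}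

lemma measurable_bernVar_mul (θ : EuclideanSpace ℝ (Fin p)) (a b : Fin p) :
    Measurable fun x : EuclideanSpace ℝ (Fin p) => bernVar (inner ℝ θ x) * (x a * x b) := by
  have h : Continuous fun x : EuclideanSpace ℝ (Fin p) => (inner ℝ θ x : ℝ) := by fun_prop
  have h2 : Continuous fun x : EuclideanSpace ℝ (Fin p) => x a * x b := by fun_prop
  exact ((continuous_bernVar.comp h).mul h2).measurable

lemma integrable_bernVar_mul (hsq : ∀ a b : Fin p, Integrable (fun x => x a * x b) μ)
    (θ : EuclideanSpace ℝ (Fin p)) (a b : Fin p) :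
    Integrable (fun x : EuclideanSpace ℝ (Fin p) => bernVar (inner ℝ θ x) * (x a * x b)) μ := by
  refine (hsq a b).norm.mono' (measurable_bernVar_mul θ a b).aestronglyMeasurable
    (Eventually.of_forall fun x => ?_)
  rw [norm_mul, Real.norm_of_nonneg (bernVar_pos _).le]
  exact mul_le_of_le_one_left (norm_nonneg _) (bernVar_le_one _)

lemma inner_sq_eq_sum (u x : EuclideanSpace ℝ (Fin p)) :
    (inner ℝ u x : ℝ) ^ 2 = ∑ a, ∑ b, x a * x b * (u a * u b) := by
  have : (inner ℝ u x : ℝ) = ∑ a, u a * x a := by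
    simp [PiLp.inner_apply, mul_comm]
  rw [this, sq, Finset.sum_mul_sum]
  refine Finset.sum_congr rfl fun a _ => Finset.sum_congr rfl fun b _ => ?_
  ring

lemma quadForm_fisherInfo (hsq : ∀ a b : Fin p, Integrable (fun x => x a * x b) μ)
    (u : EuclideanSpace ℝ (Fin p)) :
    Integrable (fun x => bernVar (inner ℝ θ x) * inner ℝ u x ^ 2) μ ∧
    quadForm (fisherInfo μ θ) u = ∫ x, bernVar (inner ℝ θ x) * inner ℝ u x ^ 2 ∂μ := by
  have hterm : ∀ a b : Fin p, Integrable (fun x : EuclideanSpace ℝ (Fin p) =>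
      bernVar (inner ℝ θ x) * (x a * x b) * (u a * u b)) μ := fun a b =>
    (integrable_bernVar_mul hsq θ a b).mul_const _
  have e : (fun x : EuclideanSpace ℝ (Fin p) => bernVar (inner ℝ θ x) * inner ℝ u x ^ 2) =
      fun x => ∑ a, ∑ b, bernVar (inner ℝ θ x) * (x a * x b) * (u a * u b) := by
    ext x
    rw [inner_sq_eq_sum]
    simp only [Finset.mul_sum]
    refine Finset.sum_congr rfl fun a _ => Finset.sum_congr rfl fun b _ => ?_
    ring
  rw [e]
  refine ⟨integrable_finsetSum _ fun a _ => integrable_finsetSum _ fun b _ => hterm a b, ?_⟩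
  rw [integral_finsetSum _ fun a _ => integrable_finsetSum _ fun b _ => hterm a b, quadForm_eq_sum]
  refine Finset.sum_congr rfl fun a _ => ?_
  rw [integral_finsetSum _ fun b _ => hterm a b]
  refine Finset.sum_congr rfl fun b _ => ?_
  rw [integral_mul_const]
  rfl

/-- As σ'' is strictly positive, a vanishing form means ⟨u, x⟩ = 0 almost surely; then u lies in the
kernel of the second moment matrix, which is trivial. -/
lemma posDef_fisherInfo (hsq : ∀ a b : Fin p, Integrable (fun x => x a * x b) μ)
    (hunit : IsUnit (Matrix.of fun a b : Fin p => ∫ x, x a * x b ∂μ))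
    (θ : EuclideanSpace ℝ (Fin p)) : (fisherInfo μ θ).PosDef := by
  refine posDef_of_quadForm_pos ?_ fun u hu => ?_
  · ext a b
    rw [Matrix.conjTranspose_apply, star_trivial]
    simp only [fisherInfo, Matrix.of_apply, mul_comm]
  · obtain ⟨hint, heq⟩ := quadForm_fisherInfo (θ := θ) hsq u
    have hnn : ∀ x : EuclideanSpace ℝ (Fin p), 0 ≤ bernVar (inner ℝ θ x) * inner ℝ u x ^ 2 :=
      fun x => mul_nonneg (bernVar_pos _).le (sq_nonneg _)
    refine lt_of_le_of_ne (by rw [heq]; exact integral_nonneg hnn) fun h0 => hu ?_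
    rw [heq] at h0
    have hae := (integral_eq_zero_iff_of_nonneg hnn hint).1 h0.symm
    have hin : ∀ᵐ x ∂μ, (inner ℝ u x : ℝ) = 0 := by
      filter_upwards [hae] with x hx
      simpa [(bernVar_pos _).ne'] using hx
    have hker : (Matrix.of fun a b : Fin p => ∫ x, x a * x b ∂μ) *ᵥ u.ofLp = 0 := by
      ext a
      simp only [Matrix.mulVec, dotProduct, Matrix.of_apply, Pi.zero_apply]
      simp only [← integral_mul_const]
      rw [← integral_finsetSum _ fun b _ => (hsq a b).mul_const _]
      refine integral_eq_zero_of_ae ?_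
      filter_upwards [hin] with x hx
      have : (inner ℝ u x : ℝ) = ∑ b, u b * x b := by simp [PiLp.inner_apply, mul_comm]
      rw [this] at hx
      rw [Pi.zero_apply, ← mul_zero (x a), ← hx, Finset.mul_sum]
      refine Finset.sum_congr rfl fun b _ => ?_
      ring
    have := (Matrix.mulVec_injective_of_isUnit hunit) (hker.trans (Matrix.mulVec_zero _).symm)
    ext a
    simp [this]

/-- The Euclidean norm is at most the ℓ¹ norm, whose cube expands into the mixed third moments. -/
lemma integrable_norm_pow_three
    (hcube : ∀ a b c : Fin p, Integrable (fun x => |x a * x b * x c|) μ) :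
    Integrable (fun x : EuclideanSpace ℝ (Fin p) => ‖x‖ ^ 3) μ := by
  refine (integrable_finsetSum Finset.univ fun a _ => integrable_finsetSum Finset.univ fun b _ =>
    integrable_finsetSum Finset.univ fun c _ => hcube a b c).mono'
    (measurable_norm.pow_const 3).aestronglyMeasurable (Eventually.of_forall fun x => ?_)
  rw [Real.norm_of_nonneg (by positivity)]
  have h1 : ‖x‖ ≤ ∑ a, |x a| := by
    rw [EuclideanSpace.norm_eq]
    refine Real.sqrt_le_iff.2 ⟨Finset.sum_nonneg fun a _ => abs_nonneg _, ?_⟩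
    exact Finset.sum_sq_le_sq_sum_of_nonneg fun a _ => norm_nonneg _
  calc ‖x‖ ^ 3 ≤ (∑ a, |x a|) ^ 3 := by gcongr
    _ = ∑ a, ∑ b, ∑ c, |x a * x b * x c| := by
      rw [pow_succ, sq, Finset.sum_mul_sum, Finset.sum_mul]
      refine Finset.sum_congr rfl fun a _ => ?_
      rw [Finset.sum_mul]
      refine Finset.sum_congr rfl fun b _ => ?_
      rw [Finset.mul_sum]
      simp only [abs_mul]

end Fisher

/-! ### Local quadratic expansion and the Bernstein-von Mises limit -/

section BernsteinVonMises

variable {m p : ℕ} {A : Matrix (Fin m) (Fin m) ℝ} {G : SimpleGraph (Fin m)}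

/-- The Fisher information matrix weighted according to agent `j`. -/
noncomputable def agentFisher (A : Matrix (Fin m) (Fin m) ℝ)
    (x : Fin m → ℕ → EuclideanSpace ℝ (Fin p)) (t : ℕ) (j : Fin m)
    (θ : EuclideanSpace ℝ (Fin p)) : Matrix (Fin p) (Fin p) ℝ :=
  Matrix.of fun a b => (t : ℝ)⁻¹ * ∑ o ∈ obsIndex m t, agentWeight A t j o *
    (bernVar (inner ℝ θ (x o.2 o.1)) * (x o.2 o.1 a * x o.2 o.1 b))

/-- The empirical third absolute moment of the covariates weighted according to agent `j`. -/
noncomputable def agentThirdMoment (A : Matrix (Fin m) (Fin m) ℝ)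
    (x : Fin m → ℕ → EuclideanSpace ℝ (Fin p)) (t : ℕ) (j : Fin m) : ℝ :=
  (t : ℝ)⁻¹ * ∑ o ∈ obsIndex m t, agentWeight A t j o * ‖x o.2 o.1‖ ^ 3

lemma mul_quadForm_agentFisher {t : ℕ} (ht : 0 < t) (x : Fin m → ℕ → EuclideanSpace ℝ (Fin p))
    (j : Fin m) (θ u : EuclideanSpace ℝ (Fin p)) :
    t * quadForm (agentFisher A x t j θ) u = ∑ o ∈ obsIndex m t, agentWeight A t j o *
      (bernVar (inner ℝ θ (x o.2 o.1)) * inner ℝ u (x o.2 o.1) ^ 2) := by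
  have ht' : (t : ℝ) ≠ 0 := Nat.cast_ne_zero.2 ht.ne'
  rw [quadForm_eq_sum]
  simp only [agentFisher, Matrix.of_apply, inner_sq_eq_sum, Finset.mul_sum, Finset.sum_mul]
  rw [Finset.sum_comm' (t' := Finset.univ) (s' := fun _ => obsIndex m t) (by simp)]
  refine Finset.sum_congr rfl fun a _ => ?_
  rw [Finset.sum_comm]
  refine Finset.sum_congr rfl fun b _ => Finset.sum_congr rfl fun o _ => ?_
  field_simp

/-- Quadratic approximation of the log-likelihood of agent `j` around its maximizer. -/
lemma abs_agentLogLik_sub_le (hA : IsCommunicationMatrix G A) {t : ℕ} (ht : 0 < t)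
    {x : Fin m → ℕ → EuclideanSpace ℝ (Fin p)} {y : Fin m → ℕ → Fin 2} {j : Fin m}
    {θh θ₀ : EuclideanSpace ℝ (Fin p)}
    (hmax : ∀ θ', agentLogLik A x y t j θ' ≤ agentLogLik A x y t j θh)
    (V : Matrix (Fin p) (Fin p) ℝ) {R : ℝ} (hR : agentThirdMoment A x t j ≤ R)
    (u : EuclideanSpace ℝ (Fin p)) :
    |agentLogLik A x y t j (θh + u) - agentLogLik A x y t j θh + t * quadForm V u / 2| ≤
      t * ((R * ‖θh - θ₀‖ + ∑ a, ∑ b, |agentFisher A x t j θ₀ a b - V a b|) * ‖u‖ ^ 2 +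
        R * ‖u‖ ^ 3) := by
  have htR : (0 : ℝ) < t := Nat.cast_pos.2 ht
  have hw : ∀ o ∈ obsIndex m t, 0 ≤ agentWeight A t j o := fun o _ => agentWeight_nonneg hA t j o
  have hsum3 : ∑ o ∈ obsIndex m t, agentWeight A t j o * ‖x o.2 o.1‖ ^ 3 ≤ t * R := by
    have : ∑ o ∈ obsIndex m t, agentWeight A t j o * ‖x o.2 o.1‖ ^ 3 =
        t * agentThirdMoment A x t j := by
      rw [agentThirdMoment, mul_inv_cancel_left₀ htR.ne']
    rw [this]
    gcongr
  have h1 := abs_logLik_taylor_le hw hmax u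
  have h2 : ∑ o ∈ obsIndex m t, agentWeight A t j o * |(inner ℝ u (x o.2 o.1) : ℝ)| ^ 3 ≤
      t * (R * ‖u‖ ^ 3) := by
    calc ∑ o ∈ obsIndex m t, agentWeight A t j o * |(inner ℝ u (x o.2 o.1) : ℝ)| ^ 3
        ≤ ∑ o ∈ obsIndex m t, agentWeight A t j o * (‖u‖ * ‖x o.2 o.1‖) ^ 3 := by
          refine Finset.sum_le_sum fun o ho => mul_le_mul_of_nonneg_left ?_ (hw o ho)
          gcongr
          exact abs_real_inner_le_norm _ _
      _ = (∑ o ∈ obsIndex m t, agentWeight A t j o * ‖x o.2 o.1‖ ^ 3) * ‖u‖ ^ 3 := by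
          rw [Finset.sum_mul]
          refine Finset.sum_congr rfl fun o _ => ?_
          ring
      _ ≤ (t * R) * ‖u‖ ^ 3 := by gcongr
      _ = t * (R * ‖u‖ ^ 3) := by ring
  -- The Hessian form at θh is moved to θ₀ by the Lipschitz bound on σ'', at the price of a third
  -- moment, and from there to V by comparing matrix entries.
  set Q : EuclideanSpace ℝ (Fin p) → ℝ := fun θ => ∑ o ∈ obsIndex m t, agentWeight A t j o *
      (bernVar (inner ℝ θ (x o.2 o.1)) * inner ℝ u (x o.2 o.1) ^ 2) with hQ
  have h3 : |Q θh - Q θ₀| ≤ t * (R * ‖θh - θ₀‖ * ‖u‖ ^ 2) := by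
    simp only [hQ]
    rw [← Finset.sum_sub_distrib]
    calc |∑ o ∈ obsIndex m t, (agentWeight A t j o *
          (bernVar (inner ℝ θh (x o.2 o.1)) * inner ℝ u (x o.2 o.1) ^ 2) - agentWeight A t j o *
          (bernVar (inner ℝ θ₀ (x o.2 o.1)) * inner ℝ u (x o.2 o.1) ^ 2))|
        ≤ ∑ o ∈ obsIndex m t, agentWeight A t j o *
          ((‖θh - θ₀‖ * ‖x o.2 o.1‖) * (‖u‖ * ‖x o.2 o.1‖) ^ 2) := by
          refine (Finset.abs_sum_le_sum_abs _ _).trans (Finset.sum_le_sum fun o ho => ?_)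
          rw [← mul_sub, ← sub_mul, abs_mul, abs_of_nonneg (hw o ho), abs_mul]
          refine mul_le_mul_of_nonneg_left ?_ (hw o ho)
          refine mul_le_mul ?_ ?_ (abs_nonneg _) (by positivity)
          · have h := abs_bernVar_add_sub_le (inner ℝ θ₀ (x o.2 o.1))
              (inner ℝ (θh - θ₀) (x o.2 o.1))
            rw [← inner_add_left, add_sub_cancel] at h
            exact h.trans (abs_real_inner_le_norm _ _)
          · rw [abs_pow]
            gcongr
            exact abs_real_inner_le_norm _ _
      _ = (∑ o ∈ obsIndex m t, agentWeight A t j o * ‖x o.2 o.1‖ ^ 3) *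
          (‖θh - θ₀‖ * ‖u‖ ^ 2) := by
          rw [Finset.sum_mul]
          refine Finset.sum_congr rfl fun o _ => ?_
          ring
      _ ≤ (t * R) * (‖θh - θ₀‖ * ‖u‖ ^ 2) := by gcongr
      _ = t * (R * ‖θh - θ₀‖ * ‖u‖ ^ 2) := by ring
  have h4 : |Q θ₀ - t * quadForm V u| ≤
      t * ((∑ a, ∑ b, |agentFisher A x t j θ₀ a b - V a b|) * ‖u‖ ^ 2) := by
    have : Q θ₀ = t * quadForm (agentFisher A x t j θ₀) u :=
      (mul_quadForm_agentFisher ht x j θ₀ u).symm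
    rw [this, ← mul_sub, abs_mul, abs_of_pos htR]
    gcongr
    exact abs_quadForm_sub_le _ _ _
  have h1' : |agentLogLik A x y t j (θh + u) - agentLogLik A x y t j θh + Q θh / 2| ≤
    t * (R * ‖u‖ ^ 3) := h1.trans h2
  rw [abs_le] at h1' h3 h4 ⊢
  constructor <;> linarith [h1'.1, h1'.2, h3.1, h3.2, h4.1, h4.2]

/-- Bernstein-von Mises theorem along a countably generated filter of data sets. -/
theorem tendsto_lintegral_pdf_sub_gaussianDensity {ι : Type*} {l : Filter ι}
    [l.IsCountablyGenerated] (hA : IsCommunicationMatrix G A) (j : Fin m)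
    {π : Fin m → EuclideanSpace ℝ (Fin p) → ℝ} (hπm : ∀ j, Measurable (π j))
    (hπ : ∀ j θ, 0 ≤ π j θ) (hπ_one : ∀ j, ∫⁻ θ, ENNReal.ofReal (π j θ) = 1)
    {θ₀ : EuclideanSpace ℝ (Fin p)} (hπ₀ : ∀ j, ContinuousAt (π j) θ₀ ∧ 0 < π j θ₀)
    {t : ι → ℕ} (ht : Tendsto t l atTop) {x : ι → Fin m → ℕ → EuclideanSpace ℝ (Fin p)}
    {y : ι → Fin m → ℕ → Fin 2} {θh : ι → EuclideanSpace ℝ (Fin p)} (hθ : Tendsto θh l (𝓝 θ₀))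
    (hmax : ∀ᶠ n in l, IsMEstimate A (x n) (y n) (t n) j (θh n))
    {V : Matrix (Fin p) (Fin p) ℝ} (hV : V.PosDef)
    (hagent : ∀ a b, Tendsto (fun n => agentFisher A (x n) (t n) j θ₀ a b) l (𝓝 (V a b)))
    (havg : ∀ a b, Tendsto (fun n => avgFisher (x n) (t n) θ₀ a b) l (𝓝 (V a b)))
    {r : ℝ} (hthird : Tendsto (fun n => agentThirdMoment A (x n) (t n) j) l (𝓝 r)) :
    Tendsto (fun n => ∫⁻ h, ENNReal.ofReal
      |(pdf (fun θ => Real.sqrt (t n) • (θ - θh n)) (posterior A (x n) (y n) π (t n) j)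
          volume h).toReal - gaussianDensity (avgFisher (x n) (t n) θ₀)⁻¹ h|) l (𝓝 0) := by
  have : NeZero m := ⟨(Fin.pos j).ne'⟩
  have hgm := measurable_geomMean hπm
  have hg0 := geomMean_nonneg hπ
  have hgi := integrable_geomMean hπm hπ hπ_one
  have hgc := continuousAt_geomMean fun j => (hπ₀ j).1
  have hgpos := geomMean_pos fun j => (hπ₀ j).2
  have hZ := lintegral_ofReal_ne_zero_of_continuousAt hgm hgc hgpos
  simp only [isMEstimate_iff] at hmax
  have hw : ∀ n, ∀ o ∈ obsIndex m (t n), 0 ≤ agentWeight A (t n) j o :=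
    fun n o _ => agentWeight_nonneg hA (t n) j o
  set R := |r| + 1 with hRd
  have hRpos : 0 < R := by positivity
  set η : ι → ℝ := fun n => R * ‖θh n - θ₀‖ +
    ∑ a, ∑ b, |agentFisher A (x n) (t n) j θ₀ a b - V a b| with hηd
  have hη : Tendsto η l (𝓝 0) := by
    have := ((tendsto_iff_norm_sub_tendsto_zero.1 hθ).const_mul R).add (tendsto_sum_abs_sub hagent)
    simpa using this
  have htpos : ∀ᶠ n in l, 0 < t n := ht.eventually_gt_atTop 0
  have htaylor : ∀ᶠ n in l, ∀ u, |agentLogLik A (x n) (y n) (t n) j (θh n + u) -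
      agentLogLik A (x n) (y n) (t n) j (θh n) + t n * quadForm V u / 2| ≤
      t n * (η n * ‖u‖ ^ 2 + R * ‖u‖ ^ 3) := by
    filter_upwards [htpos, hmax, hthird.eventually_lt_const
      (show r < R by rw [hRd]; linarith [le_abs_self r])] with n h1 h2 h3 u
    exact abs_agentLogLik_sub_le hA h1 h2 V h3.le u
  set M : ι → EuclideanSpace ℝ (Fin p) → ℝ := fun n => agentLogLik A (x n) (y n) (t n) j with hM
  have hlap := tendsto_integral_abs_localDensity_sub ht (M := M) (fun n => continuous_logLik)
    (fun n => concaveOn_logLik (hw n)) hθ hmax hV hη hRpos.le htaylor hgm hg0 hgi hgc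
  have hFint : ∀ᶠ n in l, Integrable (localDensity (M n) (geomMean π) (t n) (θh n)) := by
    filter_upwards [htpos, hmax] with n h1 h2
    exact integrable_localDensity continuous_logLik hgm hg0 hgi h1 h2
  have hVpos := integral_exp_quadForm_pos hV
  have hpost := tendsto_integral_abs_normalized_sub hFint
    ((integrable_exp_quadForm hV).mul_const (geomMean π θ₀))
    (by rw [integral_mul_const]; positivity) hlap
  have hUpd := eventually_posDef hV havg fun n => isHermitian_avgFisher (x n) (t n) θ₀
  have hUint : ∀ᶠ n in l, Integrable fun h : EuclideanSpace ℝ (Fin p) =>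
      Real.exp (-quadForm (avgFisher (x n) (t n) θ₀) h / 2) :=
    hUpd.mono fun n hn => integrable_exp_quadForm hn
  have hgauss := tendsto_integral_abs_normalized_sub hUint (integrable_exp_quadForm hV) hVpos
    (tendsto_integral_abs_exp_quadForm_sub hV havg)
  -- The comparison runs through the fixed law N(0, V⁻¹): the posterior and the normal law with
  -- empirical precision both approach it in L¹.
  have hsum := ENNReal.tendsto_ofReal (hpost.add hgauss)
  rw [add_zero, ENNReal.ofReal_zero] at hsum
  refine tendsto_of_tendsto_of_tendsto_of_le_of_le' tendsto_const_nhds hsum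
    (Eventually.of_forall fun n => zero_le) ?_
  filter_upwards [htpos, hFint, hUpd] with n h1 h2 h3
  set F := localDensity (M n) (geomMean π) (t n) (θh n) with hF
  set U := avgFisher (x n) (t n) θ₀ with hU
  have hpdf := pdf_posterior_ae_eq (x := x n) (y := y n) hA hπm hπ hgi hZ h1 j (θh n)
  have i0 : Integrable fun h : EuclideanSpace ℝ (Fin p) =>
      (∫ h, Real.exp (-quadForm V h / 2) * geomMean π θ₀)⁻¹ *
        (Real.exp (-quadForm V h / 2) * geomMean π θ₀) :=
    ((integrable_exp_quadForm hV).mul_const _).const_mul _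
  have i1 : Integrable fun h => |(∫ h, F h)⁻¹ * F h -
      (∫ h, Real.exp (-quadForm V h / 2) * geomMean π θ₀)⁻¹ *
        (Real.exp (-quadForm V h / 2) * geomMean π θ₀)| :=
    ((h2.const_mul _).sub i0).abs
  have i2 : Integrable fun h : EuclideanSpace ℝ (Fin p) =>
      |(∫ h : EuclideanSpace ℝ (Fin p), Real.exp (-quadForm U h / 2))⁻¹ *
        Real.exp (-quadForm U h / 2) -
      (∫ h : EuclideanSpace ℝ (Fin p), Real.exp (-quadForm V h / 2))⁻¹ *
        Real.exp (-quadForm V h / 2)| :=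
    (((integrable_exp_quadForm h3).const_mul _).sub
      ((integrable_exp_quadForm hV).const_mul _)).abs
  rw [← integral_add i1 i2]
  refine le_trans (lintegral_mono_ae ?_) (ofReal_integral_eq_lintegral_ofReal (i1.add i2)
    (Eventually.of_forall fun h => add_nonneg (abs_nonneg _) (abs_nonneg _))).ge
  filter_upwards [hpdf] with h hh
  refine ENNReal.ofReal_le_ofReal ?_
  rw [hh, gaussianDensity_inv_eq h3]
  -- The prior enters the limit only through its positive value at θ₀, which normalization cancels.
  have e : (∫ h : EuclideanSpace ℝ (Fin p), Real.exp (-quadForm V h / 2) * geomMean π θ₀)⁻¹ *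
      (Real.exp (-quadForm V h / 2) * geomMean π θ₀) =
      (∫ h : EuclideanSpace ℝ (Fin p), Real.exp (-quadForm V h / 2))⁻¹ *
        Real.exp (-quadForm V h / 2) := by
    rw [integral_mul_const]
    field_simp
  simp only [Pi.add_apply]
  rw [e, abs_sub_comm ((∫ h : EuclideanSpace ℝ (Fin p), Real.exp (-quadForm U h / 2))⁻¹ *
    Real.exp (-quadForm U h / 2))]
  exact abs_sub_le _ _ _

end BernsteinVonMises

/-! ### Limits of the empirical information and third moment -/

section FisherLimits

variable {m p : ℕ} {A : Matrix (Fin m) (Fin m) ℝ} {G : SimpleGraph (Fin m)} {Ω : Type*}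
  [MeasurableSpace Ω] {P : Measure Ω} [IsProbabilityMeasure P]
  {X : Fin m → ℕ → Ω → EuclideanSpace ℝ (Fin p)} {Y : Fin m → ℕ → Ω → Fin 2}
  {μ : Measure (EuclideanSpace ℝ (Fin p))} [IsProbabilityMeasure μ]
  {θ₀ : EuclideanSpace ℝ (Fin p)}

lemma tendsto_avgFisher [NeZero m] (hX : ∀ j k, Measurable (X j k)) (hY : ∀ j k, Measurable (Y j k))
    (hindep : iIndepFun (fun (jk : Fin m × ℕ) (ω : Ω) => (X jk.1 jk.2 ω, Y jk.1 jk.2 ω)) P)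
    (hlaw : ∀ j k, P.map (fun ω => (X j k ω, Y j k ω)) = pairLaw μ θ₀)
    (hsq : ∀ a b : Fin p, Integrable (fun x => x a * x b) μ) (a b : Fin p) :
    Tendsto (fun z : ℕ × Ω => avgFisher (fun i k => X i k z.2) z.1 θ₀ a b)
      (inProb P) (𝓝 (fisherInfo μ θ₀ a b)) := by
  have h := tendsto_uniform_average_covariate
    (f := fun x : EuclideanSpace ℝ (Fin p) => bernVar (inner ℝ θ₀ x) * (x a * x b))
    hX hY hindep hlaw (measurable_bernVar_mul θ₀ a b) (integrable_bernVar_mul hsq θ₀ a b)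
  exact h.congr fun z => (avgFisher_apply (fun i k => X i k z.2) z.1 θ₀ a b).symm

lemma tendsto_agentFisher (hA : IsCommunicationMatrix G A) (hX : ∀ j k, Measurable (X j k))
    (hY : ∀ j k, Measurable (Y j k))
    (hindep : iIndepFun (fun (jk : Fin m × ℕ) (ω : Ω) => (X jk.1 jk.2 ω, Y jk.1 jk.2 ω)) P)
    (hlaw : ∀ j k, P.map (fun ω => (X j k ω, Y j k ω)) = pairLaw μ θ₀)
    (hsq : ∀ a b : Fin p, Integrable (fun x => x a * x b) μ) (j : Fin m) (a b : Fin p) :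
    Tendsto (fun z : ℕ × Ω => agentFisher A (fun i k => X i k z.2) z.1 j θ₀ a b)
      (inProb P) (𝓝 (fisherInfo μ θ₀ a b)) := by
  have h := tendsto_average_covariate
    (f := fun x : EuclideanSpace ℝ (Fin p) => bernVar (inner ℝ θ₀ x) * (x a * x b))
    hA hX hY hindep hlaw (measurable_bernVar_mul θ₀ a b) (integrable_bernVar_mul hsq θ₀ a b) j
  exact h.congr fun z => rfl

lemma tendsto_agentThirdMoment (hA : IsCommunicationMatrix G A) (hX : ∀ j k, Measurable (X j k))
    (hY : ∀ j k, Measurable (Y j k))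
    (hindep : iIndepFun (fun (jk : Fin m × ℕ) (ω : Ω) => (X jk.1 jk.2 ω, Y jk.1 jk.2 ω)) P)
    (hlaw : ∀ j k, P.map (fun ω => (X j k ω, Y j k ω)) = pairLaw μ θ₀)
    (hcube : ∀ a b c : Fin p, Integrable (fun x => |x a * x b * x c|) μ) (j : Fin m) :
    Tendsto (fun z : ℕ × Ω => agentThirdMoment A (fun i k => X i k z.2) z.1 j)
      (inProb P) (𝓝 (∫ x, ‖x‖ ^ 3 ∂μ)) := by
  have h := tendsto_average_covariate (f := fun x : EuclideanSpace ℝ (Fin p) => ‖x‖ ^ 3)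
    hA hX hY hindep hlaw (measurable_norm.pow_const 3) (integrable_norm_pow_three hcube) j
  exact h.congr fun z => rfl

end FisherLimits

end DistLogistic

/-! ### The main theorem -/

open DistLogistic in
theorem proposition3
    {m p : ℕ} (G : SimpleGraph (Fin m)) (A : Matrix (Fin m) (Fin m) ℝ)
    (hA : IsCommunicationMatrix G A)
    {Ω : Type*} [MeasurableSpace Ω] (P : Measure Ω) [IsProbabilityMeasure P]
    (X : Fin m → ℕ → Ω → EuclideanSpace ℝ (Fin p)) (Y : Fin m → ℕ → Ω → Fin 2)
    (hX : ∀ j k, Measurable (X j k)) (hY : ∀ j k, Measurable (Y j k))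
    -- the pairs are i.i.d. over agents and time, generated by the logistic model at `θ₀`
    (μ : Measure (EuclideanSpace ℝ (Fin p))) [IsProbabilityMeasure μ]
    (θ₀ : EuclideanSpace ℝ (Fin p))
    (hindep : iIndepFun (fun (jk : Fin m × ℕ) (ω : Ω) => (X jk.1 jk.2 ω, Y jk.1 jk.2 ω)) P)
    (hlaw : ∀ j k, P.map (fun ω => (X j k ω, Y j k ω)) = pairLaw μ θ₀)
    -- `θ₀` is the unique minimizer of the summed Kullback-Leibler divergences
    (hmin : ∀ θ, θ ≠ θ₀ →
      ∑ _j : Fin m, InformationTheory.klDiv (pairLaw μ θ₀) (pairLaw μ θ₀) <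
        ∑ _j : Fin m, InformationTheory.klDiv (pairLaw μ θ₀) (pairLaw μ θ))
    -- the log-likelihood is integrable at every parameter
    (hlog : ∀ θ, Integrable (fun z : EuclideanSpace ℝ (Fin p) × Fin 2 =>
      Real.log (condProb θ z.1 z.2)) (pairLaw μ θ₀))
    -- an M-estimator sequence: a maximizer whenever one exists
    (θhat : Fin m → ℕ → Ω → EuclideanSpace ℝ (Fin p))
    (hθhat : ∀ j t ω,
      (∃ θ, IsMEstimate A (fun i k => X i k ω) (fun i k => Y i k ω) t j θ) →
        IsMEstimate A (fun i k => X i k ω) (fun i k => Y i k ω) t j (θhat j t ω))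
    -- the prior densities of the agents
    (π : Fin m → EuclideanSpace ℝ (Fin p) → ℝ)
    (hπ_meas : ∀ j, Measurable (π j)) (hπ_nonneg : ∀ j θ, 0 ≤ π j θ)
    (hπ_one : ∀ j, ∫⁻ θ, ENNReal.ofReal (π j θ) = 1) :
    -- existence, uniqueness and consistency of the M-estimator
    (∀ j, Tendsto
        (fun t : ℕ => P {ω | ¬ ∃! θ,
          IsMEstimate A (fun i k => X i k ω) (fun i k => Y i k ω) t j θ}) atTop (𝓝 0) ∧
      TendstoInMeasure P (θhat j) atTop (fun _ => θ₀)) ∧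
    -- Bernstein-von Mises
    ((∀ j, ContinuousAt (π j) θ₀ ∧ 0 < π j θ₀) →
      (∀ a b : Fin p, Integrable (fun x => x a * x b) μ) →
      IsUnit (Matrix.of fun a b : Fin p => ∫ x, x a * x b ∂μ) →
      (∀ a b c : Fin p, Integrable (fun x => |x a * x b * x c|) μ) →
      Tendsto (fun t : ℕ => P {ω | ¬ (avgFisher (fun i k => X i k ω) t θ₀).PosDef})
        atTop (𝓝 0) ∧
      ∀ j, ∀ ε : ℝ≥0∞, 0 < ε → Tendsto
        (fun t : ℕ => P {ω | ε ≤ ∫⁻ h, ENNReal.ofReal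
          |(pdf (fun θ => Real.sqrt t • (θ - θhat j t ω))
              (posterior A (fun i k => X i k ω) (fun i k => Y i k ω) π t j) volume h).toReal -
            gaussianDensity (avgFisher (fun i k => X i k ω) t θ₀)⁻¹ h|})
        atTop (𝓝 0)) := by
  -- Unique minimality enters as identifiability: equal laws would have equal divergences.
  have hne : ∀ θ, θ ≠ θ₀ → pairLaw μ θ ≠ pairLaw μ θ₀ := fun θ hθ h => by
    have := hmin θ hθ
    rw [h] at this
    exact lt_irrefl _ this
  have hunique : ∀ (j : Fin m) {ε : ℝ}, 0 < ε → ∀ᶠ z : ℕ × Ω in inProb P,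
      (∃! θ, IsMEstimate A (fun i k => X i k z.2) (fun i k => Y i k z.2) z.1 j θ) ∧
      ∀ θ, IsMEstimate A (fun i k => X i k z.2) (fun i k => Y i k z.2) z.1 j θ →
        dist θ θ₀ < ε := fun j ε hε =>
    eventually_existsUnique_isMEstimate hA j hε
      (eventually_agentLogLik_lt_on_sphere hA hX hY hindep hlaw hne hlog j hε)
  have hmax : ∀ j, ∀ᶠ z : ℕ × Ω in inProb P,
      IsMEstimate A (fun i k => X i k z.2) (fun i k => Y i k z.2) z.1 j (θhat j z.1 z.2) :=
    fun j => (hunique j one_pos).mono fun z hz => hθhat j z.1 z.2 hz.1.exists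
  have hcons : ∀ j, Tendsto (fun z : ℕ × Ω => θhat j z.1 z.2) (inProb P) (𝓝 θ₀) := by
    refine fun j => Metric.tendsto_nhds.2 fun ε hε => ?_
    filter_upwards [hunique j hε, hmax j] with z h1 h2 using h1.2 _ h2
  refine ⟨fun j => ⟨?_, tendstoInMeasure_of_tendsto_inProb (hcons j)⟩, ?_⟩
  · exact eventually_inProb.1 ((hunique j one_pos).mono fun z hz => hz.1)
  intro hπ₀ hsq hunit hcube
  have hV := posDef_fisherInfo hsq hunit θ₀
  have hm : NeZero m := ⟨by
    obtain ⟨i⟩ := hA.connected.nonempty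
    exact (Fin.pos i).ne'⟩
  have havg := fun a b => tendsto_avgFisher hX hY hindep hlaw hsq a b
  refine ⟨eventually_inProb.1 (eventually_posDef hV havg
    fun z => isHermitian_avgFisher (fun i k => X i k z.2) z.1 θ₀), fun j ε hε => ?_⟩
  have hagent := fun a b => tendsto_agentFisher hA hX hY hindep hlaw hsq j a b
  have hthird := tendsto_agentThirdMoment hA hX hY hindep hlaw hcube j
  -- a countably generated filter along which the finitely many statistics involved converge
  set Φ : ℕ × Ω → ℕ × EuclideanSpace ℝ (Fin p) × (Fin p → Fin p → ℝ) × (Fin p → Fin p → ℝ) × ℝ :=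
    fun z => (z.1, θhat j z.1 z.2,
      fun a b => agentFisher A (fun i k => X i k z.2) z.1 j θ₀ a b,
      fun a b => avgFisher (fun i k => X i k z.2) z.1 θ₀ a b,
      agentThirdMoment A (fun i k => X i k z.2) z.1 j) with hΦ
  set F : Filter (ℕ × EuclideanSpace ℝ (Fin p) × (Fin p → Fin p → ℝ) × (Fin p → Fin p → ℝ) × ℝ) :=
    atTop ×ˢ 𝓝 θ₀ ×ˢ 𝓝 (fun a b => fisherInfo μ θ₀ a b) ×ˢ 𝓝 (fun a b => fisherInfo μ θ₀ a b) ×ˢ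
      𝓝 (∫ x, ‖x‖ ^ 3 ∂μ) with hF
  -- `inProb P` need not be countably generated, as dominated convergence requires. Pulling back a
  -- product of `atTop` and neighbourhood filters, and intersecting with the event that the
  -- estimator is a maximizer, gives a coarser filter that is, and limits along `l` pass to `inProb
  -- P`.
  set l : Filter (ℕ × Ω) := comap Φ F ⊓ 𝓟 {z |
    IsMEstimate A (fun i k => X i k z.2) (fun i k => Y i k z.2) z.1 j (θhat j z.1 z.2)} with hl
  have hle : inProb P ≤ l := by
    refine le_inf (tendsto_iff_comap.1 ?_) (le_principal_iff.2 (hmax j))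
    exact tendsto_fst_inProb.prodMk ((hcons j).prodMk
      ((tendsto_pi_nhds.2 fun a => tendsto_pi_nhds.2 fun b => hagent a b).prodMk
        ((tendsto_pi_nhds.2 fun a => tendsto_pi_nhds.2 fun b => havg a b).prodMk hthird)))
  have hΦl : Tendsto Φ l F := tendsto_comap.mono_left inf_le_left
  have h1 := (tendsto_fst (f := (atTop : Filter ℕ))).comp hΦl
  have h2 := (tendsto_snd (f := (atTop : Filter ℕ))).comp hΦl
  have h3 := tendsto_fst.comp h2
  have h4 := tendsto_snd.comp h2
  have h5 := tendsto_fst.comp h4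
  have h6 := tendsto_snd.comp h4
  have h7 := tendsto_fst.comp h6
  have h8 := tendsto_snd.comp h6
  have hlim := tendsto_lintegral_pdf_sub_gaussianDensity (l := l) hA j hπ_meas hπ_nonneg hπ_one hπ₀
    (t := fun z => z.1) (x := fun z i k => X i k z.2) (y := fun z i k => Y i k z.2)
    (θh := fun z => θhat j z.1 z.2) h1 h3
    (mem_inf_of_right (mem_principal_self _)) hV
    (fun a b => tendsto_pi_nhds.1 (tendsto_pi_nhds.1 h5 a) b)
    (fun a b => tendsto_pi_nhds.1 (tendsto_pi_nhds.1 h7 a) b)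
    h8
  have hev := eventually_inProb.1 ((hlim.mono_left hle).eventually_lt_const hε)
  simpa only [not_lt] using hev
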